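/- For $N\ge 1$ let $P_N$ be the Legendre polynomial of degree $N$ and let $-1=\xi_0<\xi_1<\dots<\xi_N=1$ be the Gauss–Lobatto nodes, i.e. the $N+1$ roots of $(1-\xi^2)P_N'(\xi)$. Let $l_0,\dots,l_N$ be the Lagrange polynomials of these nodes, let $e_i=-\sum_{k=0}^{i-1}\mathrm{d}l_k$ $(i=1,\dots,N)$ be the edge polynomials, and let $\Lambda^1_h=\mathrm{span}\{e_1,\dots,e_N\}\subset L^2\Lambda^1([-1,1])$, where a 1-form $b(\xi)\,\mathrm{d}\xi$ is identified with $b\in L^2(-1,1)$. There is a constant $C>0$, independent of $N$, such that for every $N\ge1$ the map $$\pi_h b=\sum_{i=1}^N\Big(\int_{\xi_{i-1}}^{\xi_i} b\Big)\,e_i$$ is a bounded linear projection $\pi_h:L^2\Lambda^1([-1,1])\to\Lambda^1_h$ (it is linear and continuous, and $\pi_h b=b$ for $b\in\Lambda^1_h$), with $$\|\pi_h b\|_{L^2\Lambda^1}\le C\,\|b\|_{L^2\Lambda^1}\qquad\text{for all } b\in L^2\Lambda^1([-1,1]);$$ in particular this holds for $b=\mathrm{d}a$ for every $a\in H\Lambda^0([-1,1])$.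 -/

import Mathlib

open MeasureTheory Polynomial
open scoped ENNReal Nat

namespace MimeticSEM

/-- The Legendre polynomial `P_N` on `[-1,1]`, by the Rodrigues formula
`P_N = (2^N N!)⁻¹ (d/dX)^N (X² - 1)^N`. -/
noncomputable def legendre (N : ℕ) : ℝ[X] :=
  C (((2 : ℝ) ^ N * (N ! : ℝ))⁻¹) * derivative^[N] ((X ^ 2 - 1) ^ N)

/-- `ξ_0 < ⋯ < ξ_N` are the `N + 1` Gauss-Lobatto(-Legendre) nodes of `[-1,1]`: the roots of
`(1 - X²) P_N'`, in increasing order. For `N ≥ 1` that polynomial has degree `N + 1`, so such a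
list contains all of its roots. -/
structure IsGaussLobattoGrid (N : ℕ) (ξ : Fin (N + 1) → ℝ) : Prop where
  strictMono : StrictMono ξ
  isRoot : ∀ i, ((1 - X ^ 2) * derivative (legendre N)).IsRoot (ξ i)

/-- The Lagrange polynomial `l_i` of the nodes `ξ_0, …, ξ_N`. -/
noncomputable def lagrange {N : ℕ} (ξ : Fin (N + 1) → ℝ) (i : Fin (N + 1)) : ℝ[X] :=
  Lagrange.basis Finset.univ ξ i

/-- The edge polynomial of the edge `[ξ_{i-1}, ξ_i]`, `e_i = -∑_{k = 0}^{i-1} dl_k`, as the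
coefficient of `dξ`. The `N` edges are indexed by `Fin N`, from zero: the index `j` stands for the
edge from `ξ j.castSucc` to `ξ j.succ`, so `i = j + 1`. -/
noncomputable def edge {N : ℕ} (ξ : Fin (N + 1) → ℝ) (j : Fin N) : ℝ[X] :=
  -∑ k ∈ Finset.Iic j.castSucc, derivative (lagrange ξ k)

/-- `L²Λ¹([-1,1])`: a 1-form `b(ξ) dξ` is represented by its coefficient `b ∈ L²(-1,1)`. -/
abbrev L2Form1 : Type := Lp ℝ 2 (volume.restrict (Set.Icc (-1 : ℝ) 1))

theorem memLp_polynomial (p : ℝ[X]) :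
    MemLp (fun x => p.eval x) 2 (volume.restrict (Set.Icc (-1 : ℝ) 1)) := by
  obtain ⟨B, hB⟩ := (isCompact_Icc (a := (-1 : ℝ)) (b := 1)).exists_bound_of_continuousOn
    p.continuous.continuousOn
  exact MemLp.of_bound p.continuous.aestronglyMeasurable B
    ((ae_restrict_iff' measurableSet_Icc).2 (Filter.Eventually.of_forall hB))

/-- The `L²` 1-form `p(ξ) dξ` with polynomial coefficient `p`. -/
noncomputable def polyForm (p : ℝ[X]) : L2Form1 := (memLp_polynomial p).toLp

/-- The reduction of a 1-form to a 1-cochain: integration over the `N` edges. -/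
noncomputable def reduction {N : ℕ} (ξ : Fin (N + 1) → ℝ) (b : L2Form1) (j : Fin N) : ℝ :=
  ∫ x in (ξ j.castSucc)..(ξ j.succ), b x

/-- The reconstruction of a 1-form from a 1-cochain, `∑_i c_i e_i`. -/
noncomputable def reconstruction {N : ℕ} (ξ : Fin (N + 1) → ℝ) (c : Fin N → ℝ) : L2Form1 :=
  ∑ j, c j • polyForm (edge ξ j)

/-- The discrete space `Λ¹_h`, spanned by the edge polynomials. -/
noncomputable def discreteForms1 {N : ℕ} (ξ : Fin (N + 1) → ℝ) : Submodule ℝ L2Form1 :=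
  Submodule.span ℝ (Set.range fun j : Fin N => polyForm (edge ξ j))

end MimeticSEM

/-!
The projection is interpolation in disguise: if `A' = b`, then `π_h b = p'`, where `p` is the
polynomial of degree at most `N` with the values of `A` at the nodes
(`projection_polyForm_derivative`). So the theorem says that interpolation at the Gauss-Lobatto
nodes is stable in the `H¹` seminorm, uniformly in `N`. For fixed `N` the map is continuous on `L²`,
and polynomials are dense there (`denseRange_polyForm`); it therefore suffices to bound it on
polynomials `b`, and every integral below is the integral of a polynomial.

Expand `b` in Legendre polynomials. The part of degree less than `N` is reproduced. The rest `b₂` is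
orthogonal to these degrees and has a primitive `e = (1-X²)r` in the span of the `φ_n = (1-X²)P_n'`,
`n ≥ N`. The `φ_n` are orthogonal for the weight `(1-x²)⁻¹` and `φ_n' = -n(n+1)P_n`, whence
`N² ∫ e²/(1-x²) ≤ ∫ e'²` (`le_polyInt_derivative_sq`). The interpolant `p` of `e` lies in the span
of the `φ_n` with `n < N`, and there `∫ p'² ≤ N² ∫ p²/(1-x²)` (`polyInt_derivative_sq_le`). The last
integral is evaluated exactly by Gauss-Lobatto quadrature (`polyInt_one_sub_sq_mul_sq`): it is the
sum over the interior nodes `z` of `e(z)²/(1-z²)` times the weight `2 / (N(N+1)P_N(z)²)`.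

With `s = √(1-z²)`, two facts about the nodes remain. The weight is at most `6s/N`, because a Sonin
energy of `P_N` grows from the centre to the end points (`le_mul_sq_eval_legendre_of_isRoot`). The
next node to the right of `z` is at least `s/(4N)` away, by a Lyapunov inequality for
`(1-x²)φ_N'' + N(N+1)φ_N = 0` (`one_sub_sq_le_mul_sq_sub`). The intervals `[z, z + s/(4N)]` thus do
not overlap, and a trace inequality on each of them bounds the contribution of `z`
to `N² ∫ p²/(1-x²)` by the integral of `96 N² e²/(1-x²) + 2 e'²` up to the next node
(`node_contribution_le`). Summation gives `∫ p'² ≤ 98 ∫ b₂²`.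
-/

namespace MimeticSEM

/-! ### Integrals of polynomials over an interval -/

/-- The functional `p ↦ ∫ x in a..b, p(x)` on real polynomials. -/
noncomputable def polyInt (a b : ℝ) : ℝ[X] →ₗ[ℝ] ℝ where
  toFun p := ∫ x in a..b, p.eval x
  map_add' p q := by
    simp only [eval_add]
    exact intervalIntegral.integral_add (p.continuous.intervalIntegrable _ _)
      (q.continuous.intervalIntegrable _ _)
  map_smul' c p := by simp [eval_smul]

theorem polyInt_apply (a b : ℝ) (p : ℝ[X]) : polyInt a b p = ∫ x in a..b, p.eval x := rfl

theorem polyInt_C_mul (a b c : ℝ) (p : ℝ[X]) : polyInt a b (C c * p) = c * polyInt a b p := by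
  rw [← smul_eq_C_mul, map_smul, smul_eq_mul]

theorem polyInt_derivative (a b : ℝ) (p : ℝ[X]) :
    polyInt a b (derivative p) = p.eval b - p.eval a :=
  intervalIntegral.integral_eq_sub_of_hasDerivAt (fun x _ => p.hasDerivAt x)
    ((derivative p).continuous.intervalIntegrable _ _)

theorem polyInt_C (a b c : ℝ) : polyInt a b (C c) = c * (b - a) := by
  simp [polyInt_apply, mul_comm]

theorem polyInt_mono {a b : ℝ} (hab : a ≤ b) {p q : ℝ[X]}
    (h : ∀ x ∈ Set.Icc a b, p.eval x ≤ q.eval x) : polyInt a b p ≤ polyInt a b q :=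
  intervalIntegral.integral_mono_on hab (p.continuous.intervalIntegrable _ _)
    (q.continuous.intervalIntegrable _ _) h

theorem polyInt_nonneg {a b : ℝ} (hab : a ≤ b) {p : ℝ[X]}
    (h : ∀ x ∈ Set.Icc a b, 0 ≤ p.eval x) : 0 ≤ polyInt a b p :=
  intervalIntegral.integral_nonneg hab h

theorem polyInt_add_adjacent (a b c : ℝ) (p : ℝ[X]) :
    polyInt a b p + polyInt b c p = polyInt a c p :=
  intervalIntegral.integral_add_adjacent_intervals (p.continuous.intervalIntegrable _ _)
    (p.continuous.intervalIntegrable _ _)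

theorem polyInt_mono_right {a b c : ℝ} (hbc : b ≤ c) {p : ℝ[X]}
    (h : ∀ x ∈ Set.Icc b c, 0 ≤ p.eval x) : polyInt a b p ≤ polyInt a c p := by
  have := polyInt_nonneg hbc h
  rw [← polyInt_add_adjacent a b c]
  linarith

theorem polyInt_sq_pos {a b : ℝ} (hab : a < b) {p : ℝ[X]} (hp : p ≠ 0) :
    0 < polyInt a b (p ^ 2) := by
  obtain ⟨c, hc, hc'⟩ := ((Set.Icc_infinite hab).sdiff p.roots.toFinset.finite_toSet).nonempty
  have hc0 : p.eval c ≠ 0 := by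
    intro h
    exact hc' (by simp [hp, h])
  refine intervalIntegral.integral_pos hab (p ^ 2).continuous.continuousOn
    (fun x _ => by simp [sq_nonneg]) ⟨c, hc, ?_⟩
  rw [eval_pow]
  positivity

/-- The Cauchy-Schwarz inequality against the constant `1`. -/
theorem sq_polyInt_le {a b : ℝ} (hab : a ≤ b) (p : ℝ[X]) :
    polyInt a b p ^ 2 ≤ (b - a) * polyInt a b (p ^ 2) := by
  rcases hab.eq_or_lt with rfl | hlt
  · simp [polyInt_apply]
  set m := polyInt a b p / (b - a) with hm
  have hba : 0 < b - a := sub_pos.2 hlt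
  have h0 : 0 ≤ polyInt a b ((p - C m) ^ 2) :=
    polyInt_nonneg hab fun x _ => by rw [eval_pow]; positivity
  have h1 : (p - C m) ^ 2 = p ^ 2 - C (2 * m) * p + C (m ^ 2) := by
    simp only [C_mul, C_pow, map_ofNat]; ring
  rw [h1, map_add, map_sub, polyInt_C_mul, polyInt_C] at h0
  have h2 : polyInt a b p = m * (b - a) := by rw [hm]; field_simp
  rw [h2] at h0 ⊢
  nlinarith

theorem sum_polyInt_adjacent {n : ℕ} (ξ : Fin (n + 1) → ℝ) (p : ℝ[X]) :
    ∑ j : Fin n, polyInt (ξ j.castSucc) (ξ j.succ) p = polyInt (ξ 0) (ξ (Fin.last n)) p := by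
  induction n with
  | zero => simp [polyInt_apply]
  | succ n ih =>
    rw [Fin.sum_univ_castSucc]
    have := ih (fun i => ξ i.castSucc)
    simp only [Fin.castSucc_zero] at this
    simp only [← Fin.castSucc_succ, this, Fin.succ_last, polyInt_add_adjacent]

theorem exists_derivative_eq (p : ℝ[X]) :
    ∃ q : ℝ[X], derivative q = p ∧ q.natDegree ≤ p.natDegree + 1 := by
  refine ⟨∑ i ∈ Finset.range (p.natDegree + 1), monomial (i + 1) (p.coeff i / (i + 1)), ?_, ?_⟩
  · conv_rhs => rw [p.as_sum_range]
    rw [derivative_sum]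
    refine Finset.sum_congr rfl fun i _ => ?_
    rw [derivative_monomial]
    have : (i : ℝ) + 1 ≠ 0 := by positivity
    push_cast
    rw [div_mul_cancel₀ _ this]
  · refine natDegree_sum_le_of_forall_le _ _ fun i hi => (natDegree_monomial_le _).trans ?_
    have := Finset.mem_range.1 hi
    omega

theorem eq_of_derivative_eq {p q : ℝ[X]} (h : derivative p = derivative q) {x : ℝ}
    (hx : p.eval x = q.eval x) : p = q := by
  have h1 : derivative (p - q) = 0 := by rw [derivative_sub, h, sub_self]
  have h2 := eq_C_of_derivative_eq_zero h1
  have h3 : (p - q).eval x = 0 := by rw [eval_sub, hx, sub_self]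
  rw [h2, eval_C] at h3
  rw [h3, C_0] at h2
  exact sub_eq_zero.1 h2

/-! ### Legendre polynomials -/

theorem C_mul_legendre (N : ℕ) :
    C ((2 : ℝ) ^ N * (N ! : ℝ)) * legendre N = derivative^[N] ((X ^ 2 - 1) ^ N) := by
  rw [legendre, ← mul_assoc, ← C_mul, mul_inv_cancel₀ (by positivity), C_1, one_mul]

theorem derivative_sq_sub_one_pow (N : ℕ) :
    derivative ((X ^ 2 - 1 : ℝ[X]) ^ (N + 1)) = C (2 * (N + 1 : ℝ)) * ((X ^ 2 - 1) ^ N * X) := by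
  rw [derivative_pow_succ]
  simp [map_ofNat C 2]
  ring

theorem derivative_legendre_succ (N : ℕ) :
    derivative (legendre (N + 1)) = X * derivative (legendre N) + C (N + 1 : ℝ) * legendre N := by
  have hc : C ((2 : ℝ) ^ (N + 1) * ((N + 1)! : ℝ)) ≠ 0 := by
    rw [Ne, C_eq_zero]; positivity
  apply mul_left_cancel₀ hc
  rw [← derivative_C_mul, C_mul_legendre, ← Function.iterate_succ_apply' derivative,
    Function.iterate_succ_apply, derivative_sq_sub_one_pow, iterate_derivative_C_mul,
    iterate_derivative_mul_X, Function.iterate_succ_apply' derivative, Nat.add_sub_cancel,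
    ← C_mul_legendre, derivative_C_mul]
  simp only [Nat.factorial_succ, pow_succ, C_mul, C_add, map_natCast, map_one, nsmul_eq_mul,
    Nat.cast_mul, Nat.cast_add, Nat.cast_one]
  ring

/-- The recurrence comes from computing `(d/dX)^(N+1) (X² - 1)^(N+1)` in two ways: as
`(d/dX)^N` of the derivative of `(X² - 1)^(N+1)`, and by Leibniz' rule for the product
`(X² - 1)^N * (X² - 1)`. -/
theorem succ_mul_legendre_succ (N : ℕ) :
    C (N + 1 : ℝ) * legendre (N + 1) =
      C (N + 1 : ℝ) * (X * legendre N) + (X ^ 2 - 1) * derivative (legendre N) := by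
  have hc : C (2 * ((2 : ℝ) ^ N * (N ! : ℝ))) ≠ 0 := by
    rw [Ne, C_eq_zero]; positivity
  apply mul_left_cancel₀ hc
  -- `W k` is the `k`-th derivative of `(X² - 1)^N`.
  set W : ℕ → ℝ[X] := fun k => derivative^[k] ((X ^ 2 - 1) ^ N) with hW
  have e0 : C (2 * ((2 : ℝ) ^ N * (N ! : ℝ))) * (C (N + 1 : ℝ) * legendre (N + 1)) =
      derivative^[N + 1] ((X ^ 2 - 1) ^ (N + 1)) := by
    rw [← C_mul_legendre]
    simp [Nat.factorial_succ, pow_succ]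
    ring
  have eN : C ((2 : ℝ) ^ N * (N ! : ℝ)) * legendre N = W N := C_mul_legendre N
  have eN' : C ((2 : ℝ) ^ N * (N ! : ℝ)) * derivative (legendre N) = W (N + 1) := by
    rw [← derivative_C_mul, eN]
    simp only [hW, Function.iterate_succ_apply']
  have h1 : derivative^[N + 1] ((X ^ 2 - 1 : ℝ[X]) ^ (N + 1)) =
      C (2 * (N + 1 : ℝ)) * (W N * X + (N : ℝ[X]) * W (N - 1)) := by
    rw [Function.iterate_succ_apply, derivative_sq_sub_one_pow, iterate_derivative_C_mul,
      iterate_derivative_mul_X, nsmul_eq_mul]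
  have h2 : derivative^[N + 1] ((X ^ 2 - 1 : ℝ[X]) ^ (N + 1)) =
      (W (N + 1) * X + (N + 1 : ℝ[X]) * W N) * X +
        (N + 1 : ℝ[X]) * (W N * X + (N : ℝ[X]) * W (N - 1)) - W (N + 1) := by
    have : (X ^ 2 - 1 : ℝ[X]) ^ (N + 1) = (X ^ 2 - 1) ^ N * X * X - (X ^ 2 - 1) ^ N := by ring
    rw [this, iterate_derivative_sub, iterate_derivative_mul_X, iterate_derivative_mul_X,
      Nat.add_sub_cancel, iterate_derivative_mul_X]
    simp only [nsmul_eq_mul, hW]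
    push_cast
    ring
  rw [e0]
  have h3 : derivative^[N + 1] ((X ^ 2 - 1 : ℝ[X]) ^ (N + 1)) =
      2 * ((X ^ 2 - 1) * W (N + 1)) + 2 * (N + 1 : ℝ[X]) * (X * W N) := by
    simp only [C_mul, C_add, map_ofNat, map_natCast, map_one] at h1
    linear_combination 2 * h2 - h1
  rw [h3, ← eN, ← eN']
  simp only [C_mul, C_add, map_ofNat, map_natCast, map_one]
  ring

/-- Legendre's differential equation. -/
theorem derivative_one_sub_sq_mul_derivative_legendre (N : ℕ) :
    derivative ((1 - X ^ 2) * derivative (legendre N)) =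
      -(C ((N : ℝ) * (N + 1)) * legendre N) := by
  have h1 := congrArg derivative (succ_mul_legendre_succ N)
  have h2 := derivative_legendre_succ N
  simp only [derivative_mul, derivative_add, derivative_sub, derivative_X_pow,
    derivative_X, derivative_one, C_mul, C_add, map_natCast, map_one, derivative_natCast] at h1 h2 ⊢
  push_cast at h1 h2 ⊢
  linear_combination h1 - (N + 1 : ℝ[X]) * h2

theorem legendre_zero : legendre 0 = 1 := by simp [legendre]

theorem legendre_one : legendre 1 = X := by
  have := succ_mul_legendre_succ 0
  simpa [legendre_zero] using this

theorem natDegree_sq_sub_one_pow (N : ℕ) : ((X ^ 2 - 1 : ℝ[X]) ^ N).natDegree = 2 * N := by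
  rw [natDegree_pow, ← C_1, natDegree_X_pow_sub_C, mul_comm]

theorem coeff_legendre_self_ne_zero (N : ℕ) : (legendre N).coeff N ≠ 0 := by
  have h1 : ((X ^ 2 - 1 : ℝ[X]) ^ N).coeff (N + N) = 1 := by
    have := ((monic_X_pow_sub_C (1 : ℝ) two_ne_zero).pow N).coeff_natDegree
    rwa [C_1, natDegree_sq_sub_one_pow, two_mul] at this
  rw [legendre, coeff_C_mul, coeff_iterate_derivative, h1, nsmul_eq_mul, mul_one]
  have : 0 < (N + N).descFactorial N := Nat.descFactorial_pos.2 (by omega)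
  positivity

theorem natDegree_legendre (N : ℕ) : (legendre N).natDegree = N := by
  apply natDegree_eq_of_le_of_coeff_ne_zero _ (coeff_legendre_self_ne_zero N)
  rw [legendre]
  refine (natDegree_C_mul_le _ _).trans ((natDegree_iterate_derivative _ _).trans ?_)
  rw [natDegree_sq_sub_one_pow]
  omega

theorem legendre_ne_zero (N : ℕ) : legendre N ≠ 0 := fun h =>
  coeff_legendre_self_ne_zero N (by rw [h, coeff_zero])

theorem natDegree_derivative_legendre (N : ℕ) : (derivative (legendre N)).natDegree = N - 1 := by
  rw [natDegree_derivative, natDegree_legendre]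

theorem eval_derivative_legendre_succ (N : ℕ) (x : ℝ) :
    (derivative (legendre (N + 1))).eval x =
      x * (derivative (legendre N)).eval x + (N + 1) * (legendre N).eval x := by
  rw [derivative_legendre_succ]
  simp

theorem eval_legendre_succ (N : ℕ) (x : ℝ) :
    (legendre (N + 1)).eval x =
      x * (legendre N).eval x + (x ^ 2 - 1) / (N + 1) * (derivative (legendre N)).eval x := by
  have h := congrArg (eval x) (succ_mul_legendre_succ N)
  simp only [eval_mul, eval_C, eval_add, eval_sub, eval_pow, eval_X, eval_one] at h
  have : (N : ℝ) + 1 ≠ 0 := by positivity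
  field_simp
  linarith

theorem eval_neg_legendre (N : ℕ) (x : ℝ) :
    (legendre N).eval (-x) = (-1) ^ N * (legendre N).eval x ∧
      (derivative (legendre N)).eval (-x) = -((-1) ^ N * (derivative (legendre N)).eval x) := by
  induction N with
  | zero => simp [legendre_zero]
  | succ N ih =>
    simp only [eval_derivative_legendre_succ, eval_legendre_succ, ih.1, ih.2, pow_succ]
    constructor <;> ring

theorem eval_one_legendre (N : ℕ) : (legendre N).eval 1 = 1 := by
  induction N with
  | zero => simp [legendre_zero]
  | succ N ih => rw [eval_legendre_succ, ih]; ring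

theorem eval_neg_one_legendre_sq (N : ℕ) : (legendre N).eval (-1) ^ 2 = 1 := by
  rw [(eval_neg_legendre N 1).1, eval_one_legendre, mul_one, ← pow_mul, mul_comm, pow_mul]
  simp

theorem legendre_pos_of_one_le (N : ℕ) {x : ℝ} (hx : 1 ≤ x) :
    0 < (legendre N).eval x ∧ 0 ≤ (derivative (legendre N)).eval x := by
  induction N with
  | zero => simp [legendre_zero]
  | succ N ih =>
    obtain ⟨h1, h2⟩ := ih
    have h3 : 0 ≤ x ^ 2 - 1 := by nlinarith
    rw [eval_derivative_legendre_succ, eval_legendre_succ]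
    constructor <;> positivity

theorem derivative_legendre_pos {N : ℕ} (hN : 1 ≤ N) {x : ℝ} (hx : 1 ≤ x) :
    0 < (derivative (legendre N)).eval x := by
  obtain ⟨n, rfl⟩ := Nat.exists_eq_add_of_le' hN
  obtain ⟨h1, h2⟩ := legendre_pos_of_one_le n hx
  rw [eval_derivative_legendre_succ]
  positivity

theorem mem_Ioo_of_isRoot_derivative_legendre {N : ℕ} (hN : 1 ≤ N) {x : ℝ}
    (hx : (derivative (legendre N)).eval x = 0) : x ∈ Set.Ioo (-1 : ℝ) 1 := by
  constructor
  · by_contra! h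
    have h1 := derivative_legendre_pos hN (x := -x) (by linarith)
    rw [(eval_neg_legendre N x).2, hx] at h1
    simp at h1
  · by_contra! h
    exact (derivative_legendre_pos hN h).ne' hx

/-- Legendre polynomials are eigenvectors of the symmetric operator `p ↦ ((1-X²)p')'` for distinct
eigenvalues. -/
theorem polyInt_legendre_mul_legendre {m n : ℕ} (h : m ≠ n) :
    polyInt (-1) 1 (legendre m * legendre n) = 0 := by
  have h1 := derivative_one_sub_sq_mul_derivative_legendre m
  have h2 := derivative_one_sub_sq_mul_derivative_legendre n
  have h3 : derivative ((1 - X ^ 2) * (derivative (legendre m) * legendre n -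
      legendre m * derivative (legendre n))) =
      C ((n : ℝ) * (n + 1) - m * (m + 1)) * (legendre m * legendre n) := by
    have : (1 - X ^ 2) * (derivative (legendre m) * legendre n -
      legendre m * derivative (legendre n)) = ((1 - X ^ 2) * derivative (legendre m)) * legendre n -
        legendre m * ((1 - X ^ 2) * derivative (legendre n)) := by ring
    rw [this, derivative_sub, derivative_mul (f := (1 - X ^ 2) * derivative (legendre m)),
      derivative_mul (f := legendre m), h1, h2, C_sub]
    ring
  have h4 := congrArg (polyInt (-1) 1) h3
  rw [polyInt_derivative, polyInt_C_mul] at h4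
  simp only [eval_mul, eval_sub, eval_one, eval_pow, eval_X] at h4
  norm_num at h4
  refine h4.resolve_left fun h5 => h ?_
  have h6 : ((n : ℝ) - m) * (n + m + 1) = 0 := by linarith
  have h7 : (n : ℝ) + m + 1 ≠ 0 := by positivity
  have h8 := (mul_eq_zero.1 h6).resolve_right h7
  exact_mod_cast (sub_eq_zero.1 h8).symm

theorem exists_eq_sum_legendre (M : ℕ) {p : ℝ[X]} (hp : p.degree < M) :
    ∃ c : ℕ → ℝ, p = ∑ n ∈ Finset.range M, C (c n) * legendre n := by
  induction M generalizing p with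
  | zero =>
    refine ⟨0, ?_⟩
    simpa [Nat.WithBot.lt_zero_iff] using hp
  | succ M ih =>
    set a := p.coeff M / (legendre M).coeff M with ha
    have h1 : (p - C a * legendre M).degree < M := by
      rw [degree_lt_iff_coeff_zero]
      intro k hk
      rw [coeff_sub, coeff_C_mul]
      rcases hk.eq_or_lt with rfl | hk
      · rw [ha, div_mul_cancel₀ _ (coeff_legendre_self_ne_zero M), sub_self]
      · rw [coeff_eq_zero_of_degree_lt (n := k), coeff_eq_zero_of_natDegree_lt (n := k), mul_zero,
          sub_zero]
        · rwa [natDegree_legendre]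
        · exact hp.trans_le (by exact_mod_cast hk)
    obtain ⟨c, hc⟩ := ih h1
    refine ⟨Function.update c M a, ?_⟩
    rw [Finset.sum_range_succ, Function.update_self, ← sub_eq_iff_eq_add, hc]
    refine Finset.sum_congr rfl fun n hn => ?_
    rw [Function.update_of_ne (Finset.mem_range.1 hn).ne]

theorem polyInt_legendre_mul_eq_zero {N : ℕ} {p : ℝ[X]} (hp : p.degree < N) :
    polyInt (-1) 1 (legendre N * p) = 0 := by
  obtain ⟨c, rfl⟩ := exists_eq_sum_legendre N hp
  rw [Finset.mul_sum, map_sum]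
  refine Finset.sum_eq_zero fun n hn => ?_
  rw [mul_left_comm, polyInt_C_mul, polyInt_legendre_mul_legendre (Finset.mem_range.1 hn).ne',
    mul_zero]

theorem polyInt_legendre_sq (N : ℕ) : polyInt (-1) 1 (legendre N ^ 2) = 2 / (2 * N + 1) := by
  -- `X P_N' - N P_N` has degree less than `N`, and `(X P_N²)' = P_N² + 2 X P_N P_N'`.
  have h1 : (X * derivative (legendre N) - C (N : ℝ) * legendre N).degree < (N : WithBot ℕ) := by
    rw [degree_lt_iff_coeff_zero]
    intro k hk
    rw [coeff_sub, coeff_C_mul]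
    cases k with
    | zero =>
      obtain rfl : N = 0 := by omega
      simp
    | succ k =>
      rw [coeff_X_mul, coeff_derivative]
      rcases hk.eq_or_lt with rfl | hk
      · push_cast; ring
      · rw [coeff_eq_zero_of_natDegree_lt (n := k + 1) (by rwa [natDegree_legendre])]
        ring
  have h2 := polyInt_legendre_mul_eq_zero h1
  have h3 := polyInt_derivative (-1) 1 (X * legendre N ^ 2)
  have h4 : derivative (X * legendre N ^ 2) = C (2 * N + 1 : ℝ) * legendre N ^ 2 +
      C 2 * (legendre N * (X * derivative (legendre N) - C (N : ℝ) * legendre N)) := by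
    rw [derivative_mul, derivative_X, derivative_pow]
    simp only [C_add, C_mul, map_natCast, map_one, map_ofNat]
    push_cast
    ring
  rw [h4, map_add, polyInt_C_mul, polyInt_C_mul, h2] at h3
  simp only [eval_mul, eval_X, eval_pow, eval_one_legendre, eval_neg_one_legendre_sq] at h3
  rw [eq_div_iff (by positivity)]
  linarith

/-- Integration by parts against `(1-X²)P_N'`, which vanishes at both ends. -/
theorem polyInt_one_sub_sq_mul_derivative_legendre_mul (N : ℕ) (q : ℝ[X]) :
    polyInt (-1) 1 ((1 - X ^ 2) * derivative (legendre N) * derivative q) =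
      N * (N + 1) * polyInt (-1) 1 (legendre N * q) := by
  have h1 := polyInt_derivative (-1) 1 ((1 - X ^ 2) * derivative (legendre N) * q)
  rw [derivative_mul, derivative_one_sub_sq_mul_derivative_legendre, map_add, neg_mul, map_neg,
    mul_assoc, polyInt_C_mul] at h1
  simp only [eval_mul, eval_sub, eval_one, eval_pow, eval_X] at h1
  norm_num at h1
  linarith

/-! ### Legendre expansions and the two spectral inequalities -/

theorem polyInt_derivative_legendre_mul (m n : ℕ) :
    polyInt (-1) 1 ((1 - X ^ 2) * derivative (legendre m) * derivative (legendre n)) =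
      if m = n then (m : ℝ) * (m + 1) * (2 / (2 * m + 1)) else 0 := by
  rw [polyInt_one_sub_sq_mul_derivative_legendre_mul]
  split_ifs with h
  · rw [← h, ← pow_two, polyInt_legendre_sq]
  · rw [polyInt_legendre_mul_legendre h, mul_zero]

theorem polyInt_sum_legendre_sq (s : Finset ℕ) (c : ℕ → ℝ) :
    polyInt (-1) 1 ((∑ n ∈ s, C (c n) * legendre n) ^ 2) =
      ∑ n ∈ s, c n ^ 2 * (2 / (2 * n + 1)) := by
  rw [pow_two, Finset.sum_mul_sum, map_sum]
  refine Finset.sum_congr rfl fun m hm => ?_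
  rw [map_sum, Finset.sum_eq_single_of_mem m hm]
  · rw [show C (c m) * legendre m * (C (c m) * legendre m) = C (c m ^ 2) * legendre m ^ 2 by
      rw [C_pow]; ring, polyInt_C_mul, polyInt_legendre_sq]
  · intro n _ hn
    rw [show C (c m) * legendre m * (C (c n) * legendre n) =
      C (c m * c n) * (legendre m * legendre n) by rw [C_mul]; ring, polyInt_C_mul,
      polyInt_legendre_mul_legendre hn.symm, mul_zero]

theorem polyInt_one_sub_sq_mul_sum_sq (s : Finset ℕ) (d : ℕ → ℝ) :
    polyInt (-1) 1 ((1 - X ^ 2) * (∑ n ∈ s, C (d n) * derivative (legendre n)) ^ 2) =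
      ∑ n ∈ s, d n ^ 2 * ((n : ℝ) * (n + 1)) * (2 / (2 * n + 1)) := by
  rw [pow_two (Finset.sum _ _), Finset.sum_mul_sum, Finset.mul_sum, map_sum]
  refine Finset.sum_congr rfl fun m hm => ?_
  have key : ∀ n, polyInt (-1) 1 ((1 - X ^ 2) *
      (C (d m) * derivative (legendre m) * (C (d n) * derivative (legendre n)))) =
      d m * d n * if m = n then (m : ℝ) * (m + 1) * (2 / (2 * m + 1)) else 0 := by
    intro n
    rw [← polyInt_derivative_legendre_mul, ← polyInt_C_mul, C_mul]
    congr 1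
    ring
  rw [Finset.mul_sum, map_sum, Finset.sum_eq_single_of_mem m hm]
  · rw [key, if_pos rfl]
    ring
  · intro n _ hn
    rw [key, if_neg hn.symm, mul_zero]

theorem derivative_one_sub_sq_mul_sum (s : Finset ℕ) (d : ℕ → ℝ) :
    derivative ((1 - X ^ 2) * ∑ n ∈ s, C (d n) * derivative (legendre n)) =
      ∑ n ∈ s, C (-(d n * ((n : ℝ) * (n + 1)))) * legendre n := by
  rw [Finset.mul_sum, derivative_sum]
  refine Finset.sum_congr rfl fun n _ => ?_
  rw [mul_left_comm, derivative_C_mul, derivative_one_sub_sq_mul_derivative_legendre, C_neg,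
    C_mul (a := d n)]
  ring

/-- An inverse inequality: on the span of `(1-X²)P_n'`, `n < N`, differentiation costs at most a
factor `N` with respect to the norm with weight `(1-X²)⁻¹`. -/
theorem polyInt_derivative_sq_le {N : ℕ} {s : Finset ℕ} (hs : ∀ n ∈ s, n < N) (d : ℕ → ℝ) :
    polyInt (-1) 1
        (derivative ((1 - X ^ 2) * ∑ n ∈ s, C (d n) * derivative (legendre n)) ^ 2) ≤
      N ^ 2 *
        polyInt (-1) 1 ((1 - X ^ 2) * (∑ n ∈ s, C (d n) * derivative (legendre n)) ^ 2) := by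
  rw [derivative_one_sub_sq_mul_sum, polyInt_sum_legendre_sq, polyInt_one_sub_sq_mul_sum_sq,
    Finset.mul_sum]
  refine Finset.sum_le_sum fun n hn => ?_
  have h1 : (n : ℝ) + 1 ≤ N := by exact_mod_cast hs n hn
  have h2 : (n : ℝ) * (n + 1) ≤ N ^ 2 := by nlinarith
  calc (-(d n * ((n : ℝ) * (n + 1)))) ^ 2 * (2 / (2 * n + 1))
      = ((n : ℝ) * (n + 1)) * (d n ^ 2 * ((n : ℝ) * (n + 1)) * (2 / (2 * n + 1))) := by ring
    _ ≤ _ := by gcongr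

/-- An approximation inequality: on the span of `(1-X²)P_n'`, `n ≥ N`, the norm with weight
`(1-X²)⁻¹` is at most `N⁻¹` times the norm of the derivative. -/
theorem le_polyInt_derivative_sq {N : ℕ} {s : Finset ℕ} (hs : ∀ n ∈ s, N ≤ n) (d : ℕ → ℝ) :
    N ^ 2 * polyInt (-1) 1 ((1 - X ^ 2) * (∑ n ∈ s, C (d n) * derivative (legendre n)) ^ 2) ≤
      polyInt (-1) 1
        (derivative ((1 - X ^ 2) * ∑ n ∈ s, C (d n) * derivative (legendre n)) ^ 2) := by
  rw [derivative_one_sub_sq_mul_sum, polyInt_sum_legendre_sq, polyInt_one_sub_sq_mul_sum_sq,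
    Finset.mul_sum]
  refine Finset.sum_le_sum fun n hn => ?_
  have h1 : (N : ℝ) ≤ n := by exact_mod_cast hs n hn
  have h2 : (N : ℝ) ^ 2 ≤ (n : ℝ) * (n + 1) := by nlinarith [(Nat.cast_nonneg N : (0 : ℝ) ≤ N)]
  calc (N : ℝ) ^ 2 * (d n ^ 2 * ((n : ℝ) * (n + 1)) * (2 / (2 * n + 1)))
      ≤ ((n : ℝ) * (n + 1)) * (d n ^ 2 * ((n : ℝ) * (n + 1)) * (2 / (2 * n + 1))) := by gcongr
    _ = _ := by ring

theorem eq_one_sub_sq_mul_sum_of_derivative_eq {f : ℝ[X]} (h : f.eval (-1) = 0) {s : Finset ℕ}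
    (hs : 0 ∉ s) {c : ℕ → ℝ} (hf : derivative f = ∑ n ∈ s, C (c n) * legendre n) :
    f = (1 - X ^ 2) *
      ∑ n ∈ s, C (-(c n / ((n : ℝ) * (n + 1)))) * derivative (legendre n) := by
  refine eq_of_derivative_eq (x := -1) ?_ (by simp [h])
  rw [derivative_one_sub_sq_mul_sum, hf]
  refine Finset.sum_congr rfl fun n hn => ?_
  have h0 : (n : ℝ) ≠ 0 := by
    rintro h0
    exact hs (by rwa [Nat.cast_eq_zero.1 h0] at hn)
  have h1 : (n : ℝ) + 1 ≠ 0 := by positivity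
  congr 2
  field_simp

/-- Polynomials of degree at most `N` that vanish at `±1` are combinations of the
`(1-X²)P_n'`, `n < N`. -/
theorem exists_eq_one_sub_sq_mul_sum {N : ℕ} {f : ℝ[X]} (hf : f.natDegree ≤ N)
    (h1 : f.eval (-1) = 0) (h2 : f.eval 1 = 0) :
    ∃ d : ℕ → ℝ, f = (1 - X ^ 2) * ∑ n ∈ Finset.Ico 1 N, C (d n) * derivative (legendre n) := by
  rcases Nat.eq_zero_or_pos N with rfl | hN
  · refine ⟨0, ?_⟩
    rw [eq_C_of_natDegree_le_zero hf, eval_C] at h1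
    rw [eq_C_of_natDegree_le_zero hf, h1]
    simp
  have hd : (derivative f).degree < N := by
    rw [degree_lt_iff_coeff_zero]
    intro k hk
    rw [coeff_derivative, coeff_eq_zero_of_natDegree_lt (by omega), zero_mul]
  obtain ⟨c, hc⟩ := exists_eq_sum_legendre N hd
  rw [Finset.range_eq_Ico, Finset.sum_eq_sum_Ico_succ_bot hN] at hc
  have hc0 : c 0 = 0 := by
    have h3 := polyInt_derivative (-1) 1 f
    have h4 : polyInt (-1) 1 (∑ n ∈ Finset.Ico (0 + 1) N, C (c n) * legendre n) = 0 := by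
      rw [map_sum]
      refine Finset.sum_eq_zero fun n hn => ?_
      have hn1 : n ≠ 0 := by have := (Finset.mem_Ico.1 hn).1; omega
      have := polyInt_legendre_mul_legendre hn1
      rw [legendre_zero, mul_one] at this
      rw [polyInt_C_mul, this, mul_zero]
    rw [hc, map_add, h4, legendre_zero, mul_one, polyInt_C, h1, h2] at h3
    linarith
  rw [hc0, C_0, zero_mul, zero_add, zero_add] at hc
  exact ⟨_, eq_one_sub_sq_mul_sum_of_derivative_eq h1 (by simp) hc⟩

/-! ### Gauss quadrature at the roots of `P_N'` -/

section Quadrature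

/-! In this section `z` is a root of `P_N'` and `g = P_N' / (X - z)`. -/

variable {N : ℕ} {z : ℝ} {g : ℝ[X]}

theorem one_sub_sq_mul_eval_quotient (hg : (X - C z) * g = derivative (legendre N)) :
    (1 - z ^ 2) * g.eval z = -((N : ℝ) * (N + 1) * (legendre N).eval z) := by
  have h := derivative_one_sub_sq_mul_derivative_legendre N
  rw [← hg] at h
  have h1 := congrArg (eval z) h
  simp only [derivative_mul, derivative_sub, derivative_X, derivative_C, eval_add, eval_mul,
    eval_sub, eval_X, eval_C, eval_neg, eval_one, eval_pow, sub_self, zero_mul, sub_zero] at h1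
  linarith

theorem natDegree_quotient (hN : 1 ≤ N) (hg : (X - C z) * g = derivative (legendre N)) :
    g.natDegree + 2 = N := by
  have h0 : g ≠ 0 := by
    rintro rfl
    have := derivative_legendre_pos hN le_rfl
    rw [← hg] at this
    simp at this
  have h1 := natDegree_derivative_legendre N
  rw [← hg, natDegree_mul (X_sub_C_ne_zero z) h0, natDegree_X_sub_C] at h1
  omega

/-- `(1-X²)g` integrates polynomials of degree less than `N` as a multiple of the evaluation
at `z`. -/
theorem polyInt_one_sub_sq_mul_quotient_mul_eq (hg : (X - C z) * g = derivative (legendre N))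
    {q : ℝ[X]} (hq : q.natDegree < N) :
    polyInt (-1) 1 ((1 - X ^ 2) * g * q) =
      q.eval z * polyInt (-1) 1 ((1 - X ^ 2) * g) := by
  obtain ⟨t, ht⟩ : (X - C z) ∣ q - C (q.eval z) := by
    rw [dvd_iff_isRoot]; simp
  have h1 : (1 - X ^ 2) * g * q =
      (1 - X ^ 2) * derivative (legendre N) * t + C (q.eval z) * ((1 - X ^ 2) * g) := by
    rw [← hg]
    linear_combination (1 - X ^ 2) * g * ht
  rw [h1, map_add, polyInt_C_mul, add_eq_right]
  rcases eq_or_ne t 0 with rfl | ht0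
  · simp
  obtain ⟨T, hT, hTd⟩ := exists_derivative_eq t
  rw [← hT, polyInt_one_sub_sq_mul_derivative_legendre_mul, polyInt_legendre_mul_eq_zero, mul_zero]
  have h2 : (q - C (q.eval z)).natDegree = 1 + t.natDegree := by
    rw [ht, natDegree_mul (X_sub_C_ne_zero z) ht0, natDegree_X_sub_C]
  rw [natDegree_sub_C] at h2
  exact degree_le_natDegree.trans_lt (by exact_mod_cast (by omega : T.natDegree < N))

/-- The Gauss-Lobatto weight of an interior node, up to normalization. With `l = (1-X²)g`, the
polynomial `r = l + N P_N` has degree less than `N`, so that `∫ l r = r(z) ∫ l`; on the other hand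
`∫ l r` follows from `((X - z) l)' = -N(N+1) P_N`. -/
theorem eval_legendre_mul_polyInt_quotient (hN : 1 ≤ N)
    (hg : (X - C z) * g = derivative (legendre N)) :
    (legendre N).eval z * polyInt (-1) 1 ((1 - X ^ 2) * g) = -2 := by
  set l : ℝ[X] := (1 - X ^ 2) * g with hl
  set r : ℝ[X] := l + C (N : ℝ) * legendre N with hr
  have hdeg := natDegree_quotient hN hg
  have hrd : r.degree < N := by
    rw [degree_lt_iff_coeff_zero]
    intro j hj
    obtain ⟨j, rfl⟩ : ∃ i, j = i + 2 := ⟨j - 2, by omega⟩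
    rw [hr, hl, coeff_add, coeff_C_mul, sub_mul, one_mul, coeff_sub, mul_comm (X ^ 2) g,
      coeff_mul_X_pow, coeff_eq_zero_of_natDegree_lt (n := j + 2) (by omega)]
    rcases hj.eq_or_lt with hj | hj
    · have h1 := congrArg (fun p => coeff p (j + 1)) hg
      simp only [sub_mul, coeff_sub, coeff_X_mul, coeff_C_mul, coeff_derivative] at h1
      rw [coeff_eq_zero_of_natDegree_lt (n := j + 1) (by omega)] at h1
      rw [← hj]
      have h2 : (N : ℝ) = j + 2 := by rw [hj]; push_cast; ring
      have h3 : j + 1 + 1 = N := by omega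
      rw [h3] at h1
      push_cast at h1
      rw [h2]
      linarith
    · rw [coeff_eq_zero_of_natDegree_lt (n := j) (by omega),
        coeff_eq_zero_of_natDegree_lt (n := j + 2) (by rwa [natDegree_legendre])]
      ring
  have hrn : r.natDegree < N := by
    rcases eq_or_ne r 0 with h0 | h0
    · rw [h0, natDegree_zero]; exact hN
    · exact (natDegree_lt_iff_degree_lt h0).2 hrd
  have hone : derivative ((X - C z) * l) = -(C ((N : ℝ) * (N + 1)) * legendre N) := by
    rw [← derivative_one_sub_sq_mul_derivative_legendre, ← hg, hl]
    congr 1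
    ring
  have hlP : polyInt (-1) 1 (l * legendre N) = -(N * (2 / (2 * N + 1))) := by
    have h1 : l * legendre N = legendre N * r - C (N : ℝ) * legendre N ^ 2 := by
      rw [hr]; ring
    rw [h1, map_sub, polyInt_C_mul, polyInt_legendre_mul_eq_zero hrd, polyInt_legendre_sq, zero_sub]
  have hll : polyInt (-1) 1 (l ^ 2) = 2 * (N * (N + 1)) * (N * (2 / (2 * N + 1))) := by
    have h1 := polyInt_derivative (-1) 1 ((X - C z) * l ^ 2)
    have h2 : derivative ((X - C z) * l ^ 2) =
        -(C (2 * ((N : ℝ) * (N + 1))) * (l * legendre N)) - l ^ 2 := by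
      rw [C_mul, map_ofNat]
      rw [derivative_mul, derivative_sub, derivative_X, derivative_C] at hone ⊢
      rw [derivative_pow]
      push_cast
      rw [map_ofNat]
      linear_combination 2 * l * hone
    rw [h2, map_sub, map_neg, polyInt_C_mul, hlP] at h1
    simp only [hl, eval_mul, eval_sub, eval_one, eval_pow, eval_X] at h1
    norm_num at h1
    linarith
  have hlr : polyInt (-1) 1 (l * r) = 2 * N ^ 2 := by
    have h1 : l * r = l ^ 2 + C (N : ℝ) * (l * legendre N) := by rw [hr]; ring
    rw [h1, map_add, polyInt_C_mul, hlP, hll]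
    field_simp
    ring
  have hrz : r.eval z = -(N ^ 2 * (legendre N).eval z) := by
    have := one_sub_sq_mul_eval_quotient hg
    rw [hr, hl]
    simp only [eval_add, eval_mul, eval_sub, eval_one, eval_pow, eval_X, eval_C]
    rw [this]
    ring
  have h := polyInt_one_sub_sq_mul_quotient_mul_eq hg hrn
  rw [hlr, hrz] at h
  have hN0 : (N : ℝ) ^ 2 ≠ 0 := by positivity
  apply mul_left_cancel₀ hN0
  linarith

theorem eval_legendre_ne_zero_of_isRoot (hN : 1 ≤ N)
    (hz : (derivative (legendre N)).eval z = 0) : (legendre N).eval z ≠ 0 := by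
  intro h
  obtain ⟨g, hg⟩ := dvd_iff_isRoot.2 hz
  have := eval_legendre_mul_polyInt_quotient hN hg.symm
  rw [h] at this
  norm_num at this

end Quadrature

/-- The Gauss-Lobatto quadrature formula for `(1-X²)r²`, with its explicit weights. -/
theorem polyInt_one_sub_sq_mul_sq {m : ℕ} {η : Fin m → ℝ} (hinj : Function.Injective η)
    (hη : ∀ j, (derivative (legendre (m + 1))).eval (η j) = 0) {r : ℝ[X]} (hr : r.degree < m) :
    polyInt (-1) 1 ((1 - X ^ 2) * r ^ 2) =
      ∑ j, r.eval (η j) ^ 2 * (1 - η j ^ 2) *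
        (2 / ((m + 1 : ℝ) * (m + 2) * (legendre (m + 1)).eval (η j) ^ 2)) := by
  have hN : 1 ≤ m + 1 := by omega
  choose g hg using fun j => dvd_iff_isRoot.2 (hη j)
  have hP := fun j => eval_legendre_ne_zero_of_isRoot hN (hη j)
  have hgz := fun j => one_sub_sq_mul_eval_quotient (hg j).symm
  push_cast at hgz
  have hz : ∀ j, 1 - η j ^ 2 ≠ 0 := by
    intro j
    have := mem_Ioo_of_isRoot_derivative_legendre hN (hη j)
    nlinarith [this.1, this.2]
  have hg0 : ∀ j, (g j).eval (η j) ≠ 0 := by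
    intro j h
    have := hgz j
    rw [h, mul_zero, eq_comm, neg_eq_zero] at this
    exact mul_ne_zero (by positivity) (hP j) this
  have hsum : r = ∑ j, C (r.eval (η j) / (g j).eval (η j)) * g j := by
    refine eq_of_degrees_lt_of_eval_index_eq (v := η) Finset.univ hinj.injOn ?_ ?_ ?_
    · simpa using hr
    · rw [Finset.card_univ, Fintype.card_fin]
      refine mem_degreeLT.1 (Submodule.sum_mem _ fun j _ => ?_)
      rw [← smul_eq_C_mul]
      refine Submodule.smul_mem _ _ (mem_degreeLT.2 (degree_le_natDegree.trans_lt ?_))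
      have := natDegree_quotient hN (hg j).symm
      exact_mod_cast (by omega : (g j).natDegree < m)
    · intro i _
      rw [eval_finsetSum, Finset.sum_eq_single_of_mem i (Finset.mem_univ i)]
      · rw [eval_mul, eval_C, div_mul_cancel₀ _ (hg0 i)]
      · intro j _ hj
        have h1 := congrArg (eval (η i)) (hg j)
        rw [hη i, eval_mul, eval_sub, eval_X, eval_C, eq_comm, mul_eq_zero, sub_eq_zero] at h1
        rw [eval_mul, h1.resolve_left fun h => hj (hinj h).symm, mul_zero]
  have hrn : r.natDegree < m + 1 := by
    rcases eq_or_ne r 0 with rfl | h0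
    · simp
    · have := (natDegree_lt_iff_degree_lt h0).2 hr
      omega
  have h1 : (1 - X ^ 2) * r ^ 2 =
      ∑ j, C (r.eval (η j) / (g j).eval (η j)) * ((1 - X ^ 2) * g j * r) := by
    rw [pow_two r, ← mul_assoc]
    conv_lhs => enter [2]; rw [hsum]
    rw [Finset.mul_sum]
    exact Finset.sum_congr rfl fun j _ => by ring
  rw [h1, map_sum]
  refine Finset.sum_congr rfl fun j _ => ?_
  have h2 := eval_legendre_mul_polyInt_quotient hN (hg j).symm
  rw [polyInt_C_mul, polyInt_one_sub_sq_mul_quotient_mul_eq (hg j).symm hrn]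
  have h3 : polyInt (-1) 1 ((1 - X ^ 2) * g j) = -2 / (legendre (m + 1)).eval (η j) := by
    rw [eq_div_iff (hP j)]; linarith
  have h4 : (g j).eval (η j) =
      -((m + 1 : ℝ) * (m + 1 + 1) * (legendre (m + 1)).eval (η j)) / (1 - η j ^ 2) := by
    rw [eq_div_iff (hz j), ← hgz j]; ring
  have h5 : (m : ℝ) + 1 ≠ 0 := by positivity
  have h6 : (m : ℝ) + 2 ≠ 0 := by positivity
  have := hP j
  have := hz j
  rw [h3, h4, add_assoc (m : ℝ) 1 1, one_add_one_eq_two]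
  field_simp

/-! ### A lower bound for `P_N` at the interior nodes -/

theorem eval_zero_legendre_add_two (n : ℕ) :
    (legendre (n + 2)).eval 0 = -((n + 1) / (n + 2) * (legendre n).eval 0) := by
  rw [show n + 2 = n + 1 + 1 from rfl, eval_legendre_succ, eval_derivative_legendre_succ]
  push_cast
  have : (n : ℝ) + 2 ≠ 0 := by positivity
  have : (n : ℝ) + 1 + 1 ≠ 0 := by positivity
  field_simp
  ring

/-- `n ↦ n P_n(0)²` is nondecreasing along each parity class. -/
theorem mul_sq_eval_zero_legendre_le (n : ℕ) :
    n * (legendre n).eval 0 ^ 2 ≤ (n + 2 : ℕ) * (legendre (n + 2)).eval 0 ^ 2 := by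
  rw [eval_zero_legendre_add_two, neg_sq, mul_pow, ← mul_assoc]
  gcongr
  push_cast
  rw [div_pow, mul_div_assoc', le_div_iff₀ (by positivity)]
  have : (0 : ℝ) ≤ n := Nat.cast_nonneg n
  nlinarith

theorem half_le_sum_sq_eval_zero_legendre (n : ℕ) :
    1 / 2 ≤ (n + 1 : ℕ) * (legendre (n + 1)).eval 0 ^ 2 +
      (n + 2 : ℕ) * (legendre (n + 2)).eval 0 ^ 2 := by
  induction n with
  | zero =>
    rw [eval_zero_legendre_add_two, zero_add, legendre_one, legendre_zero]
    norm_num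
  | succ n ih =>
    have := mul_sq_eval_zero_legendre_le (n + 1)
    rw [show n + 1 + 1 = n + 2 from rfl]
    linarith

/-- An energy of Sonin type for `P_N`: up to the factor `√(1-x²)` it is `u'² + q u²`, where
`u(θ) = √(sin θ) P_N(cos θ)` solves `u'' + q u = 0` with
`q = (N + 1/2)² + 1 / (4 sin² θ)`. -/
noncomputable def legendreEnergy (N : ℕ) : ℝ[X] :=
  C ((N : ℝ) * (N + 1)) * ((1 - X ^ 2) * legendre N ^ 2) + C (1 / 2) * legendre N ^ 2 +
    ((1 - X ^ 2) * derivative (legendre N)) ^ 2 -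
    X * legendre N * ((1 - X ^ 2) * derivative (legendre N))

theorem legendreEnergy_nonneg (N : ℕ) {x : ℝ} (hx : x ^ 2 ≤ 1) :
    0 ≤ (legendreEnergy N).eval x := by
  simp only [legendreEnergy, eval_sub, eval_add, eval_mul, eval_C, eval_one, eval_pow, eval_X]
  set p := (legendre N).eval x
  set d := (1 - x ^ 2) * (derivative (legendre N)).eval x
  have h1 : 0 ≤ (N : ℝ) * (N + 1) * ((1 - x ^ 2) * p ^ 2) := by
    have : 0 ≤ 1 - x ^ 2 := by linarith
    positivity
  nlinarith [sq_nonneg (d - x * p / 2), mul_nonneg (sub_nonneg.2 hx) (sq_nonneg p), sq_nonneg p]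

theorem derivative_legendreEnergy (N : ℕ) :
    (1 - X ^ 2) * derivative (legendreEnergy N) + X * legendreEnergy N =
      C (1 / 2) * (X * legendre N ^ 2) := by
  have h := derivative_one_sub_sq_mul_derivative_legendre N
  have hC : (C (1 / 2) : ℝ[X]) * 2 = 1 := by
    rw [← map_ofNat C 2, ← C_mul]; norm_num
  set D := (1 - X ^ 2) * derivative (legendre N) with hD
  have e : derivative (legendreEnergy N) = C ((N : ℝ) * (N + 1)) * (-(2 * X) * legendre N ^ 2 +
      2 * legendre N * D) + C (1 / 2) * (2 * (legendre N * derivative (legendre N))) +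
      2 * D * derivative D - (legendre N * D + X * derivative (legendre N) * D +
        X * legendre N * derivative D) := by
    rw [legendreEnergy, ← hD]
    simp only [derivative_add, derivative_sub, derivative_mul, derivative_C, derivative_X,
      derivative_one, derivative_pow, map_natCast]
    push_cast
    rw [hD]
    ring
  rw [e, h, legendreEnergy, ← hD]
  linear_combination legendre N * D * hC + (-X * D) * hD

/-- `G² / (1-x²)` increases with `|x|`, where `G` is the energy. -/
theorem sq_legendreEnergy_zero_le (N : ℕ) {x : ℝ} (hx : x ∈ Set.Ioo (-1 : ℝ) 1) :
    (1 - x ^ 2) * (legendreEnergy N).eval 0 ^ 2 ≤ (legendreEnergy N).eval x ^ 2 := by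
  set G := legendreEnergy N with hG
  set H : ℝ → ℝ := fun y => G.eval y ^ 2 / (1 - y ^ 2) with hH
  have hpos : ∀ y ∈ Set.Ioo (-1 : ℝ) 1, 0 < 1 - y ^ 2 := fun y hy => by nlinarith [hy.1, hy.2]
  have hder : ∀ y ∈ Set.Ioo (-1 : ℝ) 1, HasDerivAt H
      (y * (G.eval y * (legendre N).eval y ^ 2 / (1 - y ^ 2) ^ 2)) y := by
    intro y hy
    have h1 := ((G.hasDerivAt y).pow 2).div (((hasDerivAt_id y).pow 2).const_sub 1) (hpos y hy).ne'
    refine h1.congr_deriv ?_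
    have h2 := congrArg (eval y) (derivative_legendreEnergy N)
    simp only [eval_sub, eval_add, eval_mul, eval_C, eval_one, eval_pow, eval_X, ← hG] at h2
    simp only [Pi.pow_apply, id]
    rw [← mul_div_assoc]
    congr 1
    push_cast
    linear_combination 2 * G.eval y * h2
  have hsub : ∀ y ∈ Set.Ioo (-1 : ℝ) 1,
      0 ≤ G.eval y * (legendre N).eval y ^ 2 / (1 - y ^ 2) ^ 2 := fun y hy => by
    have := legendreEnergy_nonneg N (x := y) (by linarith [hpos y hy])
    positivity
  have key : H 0 ≤ H x := by
    rcases le_total 0 x with h0 | h0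
    · have hs : Set.Icc 0 x ⊆ Set.Ioo (-1 : ℝ) 1 := fun y hy =>
        ⟨by linarith [hy.1], by linarith [hy.2, hx.2]⟩
      refine monotoneOn_of_deriv_nonneg (convex_Icc 0 x)
        (fun y hy => (hder y (hs hy)).continuousAt.continuousWithinAt)
        (fun y hy => (hder y (hs (interior_subset hy))).differentiableAt.differentiableWithinAt)
        (fun y hy => ?_) (Set.left_mem_Icc.2 h0) (Set.right_mem_Icc.2 h0) h0
      rw [(hder y (hs (interior_subset hy))).deriv]
      exact mul_nonneg (interior_subset hy).1 (hsub y (hs (interior_subset hy)))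
    · have hs : Set.Icc x 0 ⊆ Set.Ioo (-1 : ℝ) 1 := fun y hy =>
        ⟨by linarith [hy.1, hx.1], by linarith [hy.2]⟩
      refine antitoneOn_of_deriv_nonpos (convex_Icc x 0)
        (fun y hy => (hder y (hs hy)).continuousAt.continuousWithinAt)
        (fun y hy => (hder y (hs (interior_subset hy))).differentiableAt.differentiableWithinAt)
        (fun y hy => ?_) (Set.left_mem_Icc.2 h0) (Set.right_mem_Icc.2 h0) h0
      rw [(hder y (hs (interior_subset hy))).deriv]
      exact mul_nonpos_of_nonpos_of_nonneg (interior_subset hy).2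
        (hsub y (hs (interior_subset hy)))
  simp only [hH] at key
  rw [le_div_iff₀ (hpos x hx)] at key
  norm_num at key
  linarith

theorem half_mul_le_legendreEnergy_zero {N : ℕ} (hN : 2 ≤ N) :
    (N : ℝ) / 2 ≤ (legendreEnergy N).eval 0 := by
  obtain ⟨n, rfl⟩ := Nat.exists_eq_add_of_le' hN
  have h1 := half_le_sum_sq_eval_zero_legendre n
  have h2 := eval_derivative_legendre_succ (n + 1) 0
  simp only [legendreEnergy, eval_sub, eval_add, eval_mul, eval_C, eval_one, eval_pow, eval_X]
  rw [show n + 2 = n + 1 + 1 from rfl, h2]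
  rw [show n + 2 = n + 1 + 1 from rfl] at h1
  push_cast at h1 ⊢
  set a := (legendre (n + 1 + 1)).eval 0 ^ 2
  set b := (legendre (n + 1)).eval 0
  have ha : 0 ≤ a := sq_nonneg _
  have hn : (0 : ℝ) ≤ n := Nat.cast_nonneg n
  have h3 := mul_le_mul_of_nonneg_left h1 (by positivity : (0 : ℝ) ≤ n + 2)
  nlinarith [mul_nonneg hn ha, mul_nonneg hn (sq_nonneg b), sq_nonneg b]

/-! ### Separation of the nodes -/

/-- The Wirtinger-type identity behind the Lyapunov estimates: between two roots of
`F = (1-X²)P_N'` one has `∫ F'² = N(N+1) ∫ F²/(1-x²)`. -/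
theorem polyInt_derivative_lobatto_sq {N : ℕ} {a b : ℝ}
    (ha : ((1 - X ^ 2) * derivative (legendre N)).eval a = 0)
    (hb : ((1 - X ^ 2) * derivative (legendre N)).eval b = 0) :
    polyInt a b (derivative ((1 - X ^ 2) * derivative (legendre N)) ^ 2) =
      N * (N + 1) * polyInt a b ((1 - X ^ 2) * derivative (legendre N) ^ 2) := by
  set F := (1 - X ^ 2) * derivative (legendre N) with hF
  have h := derivative_one_sub_sq_mul_derivative_legendre N
  rw [← hF] at h
  have h1 := polyInt_derivative a b (F * derivative F)
  have h2 : derivative (F * derivative F) = derivative F ^ 2 -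
      C ((N : ℝ) * (N + 1)) * ((1 - X ^ 2) * derivative (legendre N) ^ 2) := by
    rw [derivative_mul]
    have : derivative (derivative F) = -(C ((N : ℝ) * (N + 1)) * derivative (legendre N)) := by
      rw [h, derivative_neg, derivative_C_mul]
    rw [this, hF]
    ring
  rw [h2, map_sub, polyInt_C_mul, eval_mul (p := F) (x := b), eval_mul (p := F) (x := a), ha,
    hb] at h1
  linarith

theorem derivative_lobatto_ne_zero {N : ℕ} (hN : 1 ≤ N) :
    derivative ((1 - X ^ 2) * derivative (legendre N)) ≠ 0 := by
  rw [derivative_one_sub_sq_mul_derivative_legendre]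
  have : (N : ℝ) * (N + 1) ≠ 0 := by positivity
  exact neg_ne_zero.2 (mul_ne_zero (C_ne_zero.2 this) (legendre_ne_zero N))

theorem sq_eval_le_of_eval_eq_zero {f : ℝ[X]} {a b x : ℝ} (hx : x ∈ Set.Icc a b)
    (ha : f.eval a = 0) :
    f.eval x ^ 2 ≤ (x - a) * polyInt a b (derivative f ^ 2) := by
  have h1 := sq_polyInt_le hx.1 (derivative f)
  rw [polyInt_derivative, ha, sub_zero] at h1
  refine h1.trans (mul_le_mul_of_nonneg_left ?_ (sub_nonneg.2 hx.1))
  exact polyInt_mono_right hx.2 fun y _ => by rw [eval_pow]; positivity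

theorem sq_eval_le_of_eval_eq_zero_right {f : ℝ[X]} {a b x : ℝ} (hx : x ∈ Set.Icc a b)
    (hb : f.eval b = 0) :
    f.eval x ^ 2 ≤ (b - x) * polyInt a b (derivative f ^ 2) := by
  have h1 := sq_polyInt_le hx.2 (derivative f)
  rw [polyInt_derivative, hb, zero_sub, neg_sq] at h1
  refine h1.trans (mul_le_mul_of_nonneg_left ?_ (sub_nonneg.2 hx.2))
  have h2 : 0 ≤ polyInt a x (derivative f ^ 2) :=
    polyInt_nonneg hx.1 fun y _ => by rw [eval_pow]; positivity
  rw [← polyInt_add_adjacent a x b]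
  linarith

/-- The last interior node stays away from `1`. The coefficient of the equation of `(1-X²)P_N'` is
singular there; `F(x)² ≤ (1-x) ∫ F'²` compensates for the singularity. -/
theorem one_le_mul_one_sub_of_isRoot {N : ℕ} (hN : 1 ≤ N) {z : ℝ}
    (hz : (derivative (legendre N)).eval z = 0) : 1 ≤ (N : ℝ) * (N + 1) * (1 - z) := by
  have hN1 : (1 : ℝ) ≤ N := by exact_mod_cast hN
  have hzI := mem_Ioo_of_isRoot_derivative_legendre hN hz
  rcases le_total z 0 with h0 | h0
  · exact one_le_mul_of_one_le_of_one_le (by nlinarith) (by linarith)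
  have ha : ((1 - X ^ 2) * derivative (legendre N)).eval z = 0 := by simp [hz]
  have hb : ((1 - X ^ 2) * derivative (legendre N)).eval 1 = 0 := by simp
  set F := (1 - X ^ 2) * derivative (legendre N) with hF
  set I := polyInt z 1 (derivative F ^ 2) with hI
  have hIpos : 0 < I := polyInt_sq_pos hzI.2 (derivative_lobatto_ne_zero hN)
  have h1 : I = N * (N + 1) * polyInt z 1 ((1 - X ^ 2) * derivative (legendre N) ^ 2) :=
    polyInt_derivative_lobatto_sq ha hb
  have h2 : polyInt z 1 ((1 - X ^ 2) * derivative (legendre N) ^ 2) ≤ polyInt z 1 (C I) := by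
    refine polyInt_mono hzI.2.le fun x hx => ?_
    have h3 := sq_eval_le_of_eval_eq_zero_right hx hb
    simp only [hF, eval_mul, eval_sub, eval_one, eval_pow, eval_X, eval_C] at h3 ⊢
    rw [← hF, ← hI] at h3
    set d := (derivative (legendre N)).eval x
    rcases hx.2.eq_or_lt with rfl | hx1
    · simpa using hIpos.le
    · -- Cancel `1 - x` and drop the factor `1 + x ≥ 1`.
      have hx0 : 0 ≤ x := h0.trans hx.1
      have h4 : (1 - x) * ((1 - x ^ 2) * d ^ 2 * (1 + x)) ≤ (1 - x) * I := by
        calc _ = ((1 - x ^ 2) * d) ^ 2 := by ring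
          _ ≤ _ := h3
      have h5 := le_of_mul_le_mul_left h4 (by linarith)
      have h6 : 0 ≤ (1 - x ^ 2) * d ^ 2 := by
        have : 0 ≤ 1 - x ^ 2 := by nlinarith
        positivity
      nlinarith
  rw [polyInt_C] at h2
  have h3 : I * 1 ≤ I * (N * (N + 1) * (1 - z)) := by
    have := mul_le_mul_of_nonneg_left h2 (by positivity : (0 : ℝ) ≤ N * (N + 1))
    linarith
  exact le_of_mul_le_mul_left h3 hIpos

/-- Interior nodes stay away from `±1`: the one-sided estimate at `z` and at the mirror node `-z`. -/
theorem one_le_mul_one_sub_sq_of_isRoot {N : ℕ} (hN : 1 ≤ N) {z : ℝ}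
    (hz : (derivative (legendre N)).eval z = 0) : 1 ≤ (N : ℝ) * (N + 1) * (1 - z ^ 2) := by
  have h1 := one_le_mul_one_sub_of_isRoot hN hz
  have h2 := one_le_mul_one_sub_of_isRoot hN (z := -z) (by
    rw [(eval_neg_legendre N z).2, hz]; simp)
  have hzI := mem_Ioo_of_isRoot_derivative_legendre hN hz
  have hν : (0 : ℝ) ≤ N * (N + 1) := by positivity
  rcases le_total z 0 with h0 | h0
  · nlinarith [mul_nonneg (mul_nonneg hν (neg_nonneg.2 h0)) (by linarith [hzI.1] : 0 ≤ 1 + z)]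
  · nlinarith [mul_nonneg (mul_nonneg hν h0) (by linarith [hzI.2] : 0 ≤ 1 - z)]

/-- Lyapunov's inequality for the nodes: on `[a, b]` the coefficient `N(N+1)/(1-x²)` of the equation
`F'' + N(N+1)/(1-x²) F = 0`, `F = (1-X²)P_N'`, is at most `N(N+1)/μ`. -/
theorem min_le_mul_sq_sub_of_isRoot {N : ℕ} (hN : 1 ≤ N) {a b μ : ℝ} (hab : a < b)
    (hμ0 : 0 < μ) (hμ : ∀ x ∈ Set.Icc a b, μ ≤ 1 - x ^ 2)
    (ha : ((1 - X ^ 2) * derivative (legendre N)).eval a = 0)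
    (hb : ((1 - X ^ 2) * derivative (legendre N)).eval b = 0) :
    μ ≤ N * (N + 1) * (b - a) ^ 2 := by
  set F := (1 - X ^ 2) * derivative (legendre N) with hF
  set I := polyInt a b (derivative F ^ 2) with hI
  have hIpos : 0 < I := polyInt_sq_pos hab (derivative_lobatto_ne_zero hN)
  have h1 : I = N * (N + 1) * polyInt a b ((1 - X ^ 2) * derivative (legendre N) ^ 2) :=
    polyInt_derivative_lobatto_sq ha hb
  have h2 : polyInt a b ((1 - X ^ 2) * derivative (legendre N) ^ 2) ≤
      polyInt a b (C ((b - a) * I / μ)) := by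
    refine polyInt_mono hab.le fun x hx => ?_
    have h3 := sq_eval_le_of_eval_eq_zero hx ha
    rw [eval_C, le_div_iff₀ hμ0]
    simp only [hF, eval_mul, eval_sub, eval_one, eval_pow, eval_X] at h3 ⊢
    rw [← hF, ← hI] at h3
    set d := (derivative (legendre N)).eval x
    have h4 := hμ x hx
    calc (1 - x ^ 2) * d ^ 2 * μ ≤ (1 - x ^ 2) * d ^ 2 * (1 - x ^ 2) := by
          have : 0 ≤ 1 - x ^ 2 := hμ0.le.trans h4
          gcongr
      _ = ((1 - x ^ 2) * d) ^ 2 := by ring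
      _ ≤ (x - a) * I := h3
      _ ≤ (b - a) * I := by gcongr; exact hx.2
  rw [polyInt_C] at h2
  have h3 : I * μ ≤ I * (N * (N + 1) * (b - a) ^ 2) := by
    have := mul_le_mul_of_nonneg_left h2 (by positivity : (0 : ℝ) ≤ N * (N + 1))
    rw [← h1] at this
    have h4 := mul_le_mul_of_nonneg_right this hμ0.le
    calc I * μ ≤ _ := h4
      _ = _ := by field_simp
  exact le_of_mul_le_mul_left h3 hIpos

/-- The distance from an interior node `a` to any node on its right is at least
`√(1-a²) / (4N)`. -/
theorem one_sub_sq_le_mul_sq_sub {N : ℕ} (hN : 1 ≤ N) {a b : ℝ} (hab : a < b) (hb1 : b ≤ 1)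
    (ha : (derivative (legendre N)).eval a = 0)
    (hb : ((1 - X ^ 2) * derivative (legendre N)).eval b = 0) :
    1 - a ^ 2 ≤ (4 * N * (b - a)) ^ 2 := by
  have hN1 : (1 : ℝ) ≤ N := by exact_mod_cast hN
  have haI := mem_Ioo_of_isRoot_derivative_legendre hN ha
  have hs : 0 < 1 - a ^ 2 := by nlinarith [haI.1, haI.2]
  have hν : (N : ℝ) * (N + 1) ≤ 2 * N ^ 2 := by nlinarith
  rcases le_total ((1 - a ^ 2) / 4) (1 - b ^ 2) with h | h
  · have h1 := min_le_mul_sq_sub_of_isRoot hN hab (by positivity : 0 < (1 - a ^ 2) / 4)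
      (fun x hx => by nlinarith [mul_nonneg (sub_nonneg.2 hx.1) (sub_nonneg.2 hx.2), hx.1, hx.2])
      (by simp [ha]) hb
    have h2 := mul_le_mul_of_nonneg_right hν (sq_nonneg (b - a))
    nlinarith [sq_nonneg ((N : ℝ) * (b - a))]
  · -- Here `b` is much closer to `1` than `a`, and `b - a ≥ (b² - a²) / 2 ≥ 3 (1-a²) / 8`.
    have h1 : 3 / 8 * (1 - a ^ 2) ≤ b - a := by nlinarith
    have h2 := one_le_mul_one_sub_sq_of_isRoot hN ha
    have h3 : 1 ≤ 2 * (N : ℝ) ^ 2 * (1 - a ^ 2) := h2.trans (by gcongr)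
    have h4 : (3 / 8 * (1 - a ^ 2)) ^ 2 ≤ (b - a) ^ 2 := by gcongr
    calc 1 - a ^ 2 ≤ (1 - a ^ 2) * (2 * (N : ℝ) ^ 2 * (1 - a ^ 2)) := by nlinarith
      _ ≤ 16 * (N : ℝ) ^ 2 * (3 / 8 * (1 - a ^ 2)) ^ 2 := by
        nlinarith [sq_nonneg ((N : ℝ) * (1 - a ^ 2))]
      _ ≤ 16 * (N : ℝ) ^ 2 * (b - a) ^ 2 := by gcongr
      _ = _ := by ring

/-! ### Stability of Gauss-Lobatto interpolation -/

/-- The Sonin energy bounds `P_N` from below at its critical points: `P_N(z)²` is at least of the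
order of `1 / (N √(1-z²))`. -/
theorem le_mul_sq_eval_legendre_of_isRoot {N : ℕ} (hN : 2 ≤ N) {z : ℝ}
    (hz : (derivative (legendre N)).eval z = 0) :
    (N : ℝ) ≤ 3 * √(1 - z ^ 2) * (N * (N + 1)) * (legendre N).eval z ^ 2 := by
  have hN1 : 1 ≤ N := by omega
  have hzI := mem_Ioo_of_isRoot_derivative_legendre hN1 hz
  have hs2 : 0 < 1 - z ^ 2 := by nlinarith [hzI.1, hzI.2]
  set s := √(1 - z ^ 2) with hs
  have hspos : 0 < s := Real.sqrt_pos.2 hs2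
  have hss : s ^ 2 = 1 - z ^ 2 := Real.sq_sqrt hs2.le
  have h1 := sq_legendreEnergy_zero_le N hzI
  have h2 := half_mul_le_legendreEnergy_zero hN
  have h3 := one_le_mul_one_sub_sq_of_isRoot hN1 hz
  have h4 : (legendreEnergy N).eval z =
      (N * (N + 1) * s ^ 2 + 1 / 2) * (legendre N).eval z ^ 2 := by
    simp only [legendreEnergy, eval_sub, eval_add, eval_mul, eval_C, eval_one, eval_pow, eval_X, hz,
      hss]
    ring
  rw [← hss] at h1 h3
  have h5 : s * (legendreEnergy N).eval 0 ≤ (legendreEnergy N).eval z := by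
    refine le_of_sq_le_sq ?_ (legendreEnergy_nonneg N (by linarith))
    rwa [mul_pow]
  set P2 := (legendre N).eval z ^ 2
  have hP2 : 0 ≤ P2 := sq_nonneg _
  have h6 : s * (N / 2) ≤ 3 / 2 * (N * (N + 1) * s ^ 2) * P2 := by
    calc s * (N / 2) ≤ s * (legendreEnergy N).eval 0 := by gcongr
      _ ≤ (N * (N + 1) * s ^ 2 + 1 / 2) * P2 := h5.trans_eq h4
      _ ≤ _ := by gcongr; linarith
  have h7 : s * N ≤ s * (3 * s * (N * (N + 1)) * P2) := by linarith
  exact le_of_mul_le_mul_left h7 hspos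

/-- A trace inequality on the interval `[a, a + h]`. -/
theorem mul_sq_eval_le_polyInt (e : ℝ[X]) {a h : ℝ} (hh : 0 ≤ h) :
    h * e.eval a ^ 2 ≤
      polyInt a (a + h) (C 2 * e ^ 2 + C (h ^ 2) * derivative e ^ 2) := by
  have h1 := polyInt_derivative a (a + h) ((X - C (a + h)) * e ^ 2)
  simp only [eval_mul, eval_sub, eval_X, eval_C, eval_pow, sub_self, zero_mul] at h1
  have h2 : h * e.eval a ^ 2 = polyInt a (a + h) (derivative ((X - C (a + h)) * e ^ 2)) := by
    rw [h1]; ring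
  rw [h2]
  refine polyInt_mono (by linarith) fun x hx => ?_
  simp only [derivative_mul, derivative_sub, derivative_X, derivative_C, derivative_pow, eval_add,
    eval_mul, eval_sub, eval_X, eval_C, eval_pow, eval_one, eval_zero]
  have h3 : (x - (a + h)) ^ 2 ≤ h ^ 2 := by nlinarith [hx.1, hx.2]
  have h4 := mul_le_mul_of_nonneg_right h3 (sq_nonneg ((derivative e).eval x))
  have h5 := sq_nonneg (e.eval x - (x - (a + h)) * (derivative e).eval x)
  norm_num
  nlinarith

/-- The contribution of one interior node `z` to the quadrature formula is controlled by the
integrals over the interval between `z` and the next node `b`. -/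
theorem node_contribution_le {N : ℕ} (hN : 2 ≤ N) {z b : ℝ} (hzb : z < b) (hb1 : b ≤ 1)
    (hz : (derivative (legendre N)).eval z = 0)
    (hb : ((1 - X ^ 2) * derivative (legendre N)).eval b = 0) (r : ℝ[X]) :
    N ^ 2 * (r.eval z ^ 2 * (1 - z ^ 2) *
        (2 / (N * (N + 1) * (legendre N).eval z ^ 2))) ≤
      polyInt z b (C (96 * N ^ 2 : ℝ) * ((1 - X ^ 2) * r ^ 2) +
        C 2 * derivative ((1 - X ^ 2) * r) ^ 2) := by
  have hN1 : 1 ≤ N := by omega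
  have hNpos : (0 : ℝ) < N := by exact_mod_cast hN1
  have hN1' : (1 : ℝ) ≤ N := by exact_mod_cast hN1
  have hzI := mem_Ioo_of_isRoot_derivative_legendre hN1 hz
  have hs2 : 0 < 1 - z ^ 2 := by nlinarith [hzI.1, hzI.2]
  have hP := le_mul_sq_eval_legendre_of_isRoot hN hz
  have hP0 := eval_legendre_ne_zero_of_isRoot hN1 hz
  have hsep := one_sub_sq_le_mul_sq_sub hN1 hzb hb1 hz hb
  have hend := one_le_mul_one_sub_sq_of_isRoot hN1 hz
  set s := √(1 - z ^ 2) with hs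
  have hspos : 0 < s := Real.sqrt_pos.2 hs2
  have hss : s ^ 2 = 1 - z ^ 2 := Real.sq_sqrt hs2.le
  rw [← hss] at hsep hend ⊢
  set e := (1 - X ^ 2) * r with he
  set h := s / (4 * N) with hh
  have hhpos : 0 < h := by positivity
  have hsh : s = 4 * N * h := by rw [hh]; field_simp
  have hhb : z + h ≤ b := by
    have h1 : s ≤ 4 * N * (b - z) :=
      le_of_sq_le_sq hsep (mul_nonneg (by positivity) (sub_nonneg.2 hzb.le))
    rw [hsh] at h1
    have := le_of_mul_le_mul_left h1 (by positivity)
    linarith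
  have h2N : 1 ≤ 2 * N * s := by
    refine le_of_sq_le_sq ?_ (by positivity)
    have : (N : ℝ) * (N + 1) ≤ 4 * N ^ 2 := by nlinarith
    calc (1 : ℝ) ^ 2 ≤ N * (N + 1) * s ^ 2 := by linarith
      _ ≤ 4 * N ^ 2 * s ^ 2 := by gcongr
      _ = _ := by ring
  -- On `[z, z + h]` the weight `1 - x²` is at most twice its value at `z`.
  have h2h : 2 * h ≤ s ^ 2 := by
    have h1 : 2 * h * (2 * N) = s := by rw [hsh]; ring
    have h2 : 2 * h * 1 ≤ 2 * h * (2 * N * s) := by gcongr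
    have h3 : 2 * h * (2 * N * s) = s ^ 2 := by rw [← mul_assoc, h1]; ring
    linarith
  have htrace := mul_sq_eval_le_polyInt e hhpos.le (a := z)
  have hle : polyInt z (z + h) (C 2 * e ^ 2 + C (h ^ 2) * derivative e ^ 2) ≤
      polyInt z (z + h) (C (4 * s ^ 2) * ((1 - X ^ 2) * r ^ 2) + C (h ^ 2) * derivative e ^ 2) := by
    refine polyInt_mono (by linarith) fun x hx => ?_
    simp only [he, eval_add, eval_mul, eval_C, eval_pow, eval_sub, eval_one, eval_X]
    have hx0 : 0 ≤ 1 - x ^ 2 := by nlinarith [hx.1, hx.2, hzI.1]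
    have hx1 : 1 - x ^ 2 ≤ 2 * s ^ 2 := by
      have h1 : (x - z) * (-(x + z)) ≤ (x - z) * 2 :=
        mul_le_mul_of_nonneg_left (by linarith [hx.1, hzI.1]) (by linarith [hx.1])
      have h2 := hx.2
      nlinarith
    have h1 : (1 - x ^ 2) * (1 - x ^ 2) * r.eval x ^ 2 ≤
        2 * s ^ 2 * (1 - x ^ 2) * r.eval x ^ 2 := by gcongr
    linarith
  have hbig : polyInt z (z + h) (C (96 * N ^ 2 : ℝ) * ((1 - X ^ 2) * r ^ 2) +
        C 2 * derivative e ^ 2) ≤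
      polyInt z b (C (96 * N ^ 2 : ℝ) * ((1 - X ^ 2) * r ^ 2) + C 2 * derivative e ^ 2) := by
    refine polyInt_mono_right hhb fun x hx => ?_
    simp only [eval_add, eval_mul, eval_C, eval_pow, eval_sub, eval_one, eval_X]
    have hx0 : 0 ≤ 1 - x ^ 2 := by nlinarith [hx.1, hx.2, hzI.1]
    positivity
  refine le_trans ?_ hbig
  have hD : 0 ≤ polyInt z (z + h) (derivative e ^ 2) :=
    polyInt_nonneg (by linarith) fun x _ => by rw [eval_pow]; positivity
  have hez : e.eval z = s ^ 2 * r.eval z := by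
    rw [hss, he]; simp
  rw [hez] at htrace
  simp only [map_add, polyInt_C_mul] at htrace hle ⊢
  set A := polyInt z (z + h) ((1 - X ^ 2) * r ^ 2)
  set B := polyInt z (z + h) (derivative e ^ 2)
  have hw : 2 / (N * (N + 1) * (legendre N).eval z ^ 2) ≤ 6 * s / N := by
    rw [div_le_div_iff₀ (by positivity) hNpos]
    linarith
  calc (N : ℝ) ^ 2 * (r.eval z ^ 2 * s ^ 2 * (2 / (N * (N + 1) * (legendre N).eval z ^ 2)))
      ≤ N ^ 2 * (r.eval z ^ 2 * s ^ 2 * (6 * s / N)) := by gcongr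
    _ = 24 * N ^ 2 / s ^ 2 * (h * (s ^ 2 * r.eval z) ^ 2) := by
        rw [hh]; field_simp; ring
    _ ≤ 24 * N ^ 2 / s ^ 2 * (4 * s ^ 2 * A + h ^ 2 * B) := by
        gcongr; exact htrace.trans hle
    _ = 96 * N ^ 2 * A + 3 / 2 * B := by rw [hh]; field_simp; ring
    _ ≤ _ := by linarith

namespace IsGaussLobattoGrid

variable {N : ℕ} {ξ : Fin (N + 1) → ℝ}

theorem mem_Icc (hN : 1 ≤ N) (hξ : IsGaussLobattoGrid N ξ) (i : Fin (N + 1)) :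
    ξ i ∈ Set.Icc (-1 : ℝ) 1 := by
  have h := hξ.isRoot i
  rw [IsRoot, eval_mul, mul_eq_zero] at h
  rcases h with h | h
  · simp only [eval_sub, eval_one, eval_pow, eval_X] at h
    constructor <;> nlinarith
  · exact Set.Ioo_subset_Icc_self (mem_Ioo_of_isRoot_derivative_legendre hN h)

/-- The polynomial `(1-X²)P_N'` has degree `N + 1`, so that a grid contains all its roots. -/
theorem exists_eq_of_isRoot (hN : 1 ≤ N) (hξ : IsGaussLobattoGrid N ξ) {x : ℝ}
    (hx : ((1 - X ^ 2) * derivative (legendre N)).IsRoot x) : ∃ i, ξ i = x := by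
  set Q := (1 - X ^ 2) * derivative (legendre N) with hQ
  have hQ0 : Q ≠ 0 := by
    intro h
    apply derivative_lobatto_ne_zero hN
    rw [← hQ, h, derivative_zero]
  have hdeg : Q.natDegree ≤ N + 1 := by
    have h1 : (1 - X ^ 2 : ℝ[X]).natDegree ≤ 2 := by compute_degree
    have h2 := natDegree_derivative_legendre N
    have h3 := natDegree_mul_le (p := (1 - X ^ 2 : ℝ[X])) (q := derivative (legendre N))
    rw [← hQ] at h3
    omega
  have hsub : Finset.univ.image ξ ⊆ Q.roots.toFinset := by
    intro y hy
    obtain ⟨i, -, rfl⟩ := Finset.mem_image.1 hy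
    rw [Multiset.mem_toFinset, mem_roots hQ0]
    exact hξ.isRoot i
  have hcard : Q.roots.toFinset.card ≤ (Finset.univ.image ξ).card := by
    rw [Finset.card_image_of_injective _ hξ.strictMono.injective, Finset.card_univ,
      Fintype.card_fin]
    exact (Multiset.toFinset_card_le _).trans ((card_roots' Q).trans hdeg)
  have heq := Finset.eq_of_subset_of_card_le hsub hcard
  have hmem : x ∈ Finset.univ.image ξ := by
    rw [heq, Multiset.mem_toFinset, mem_roots hQ0]
    exact hx
  obtain ⟨i, -, hi⟩ := Finset.mem_image.1 hmem
  exact ⟨i, hi⟩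

theorem apply_zero (hN : 1 ≤ N) (hξ : IsGaussLobattoGrid N ξ) : ξ 0 = -1 := by
  obtain ⟨i, hi⟩ := hξ.exists_eq_of_isRoot hN (x := -1) (by simp [IsRoot])
  have := hξ.strictMono.monotone (Fin.zero_le i)
  exact le_antisymm (by linarith) (hξ.mem_Icc hN 0).1

theorem apply_last (hN : 1 ≤ N) (hξ : IsGaussLobattoGrid N ξ) : ξ (Fin.last N) = 1 := by
  obtain ⟨i, hi⟩ := hξ.exists_eq_of_isRoot hN (x := 1) (by simp [IsRoot])
  have := hξ.strictMono.monotone (Fin.le_last i)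
  exact le_antisymm (hξ.mem_Icc hN _).2 (by linarith)

theorem eval_derivative_legendre_eq_zero (hN : 1 ≤ N) (hξ : IsGaussLobattoGrid N ξ)
    {i : Fin (N + 1)} (h0 : 0 < i) (h1 : i < Fin.last N) :
    (derivative (legendre N)).eval (ξ i) = 0 := by
  have h := hξ.isRoot i
  rw [IsRoot, eval_mul, mul_eq_zero] at h
  refine h.resolve_left fun h => ?_
  have h2 := hξ.strictMono h0
  have h3 := hξ.strictMono h1
  rw [hξ.apply_zero hN] at h2
  rw [hξ.apply_last hN] at h3
  simp only [eval_sub, eval_one, eval_pow, eval_X] at h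
  nlinarith

end IsGaussLobattoGrid

/-- Stability of interpolation at the Gauss-Lobatto nodes, for polynomials `(1-X²)r` of any
degree. -/
theorem polyInt_derivative_interpolant_sq_le {N : ℕ} (hN : 1 ≤ N) {ξ : Fin (N + 1) → ℝ}
    (hξ : IsGaussLobattoGrid N ξ) {p r : ℝ[X]} (hp : p.natDegree ≤ N)
    (hpr : ∀ i, p.eval (ξ i) = ((1 - X ^ 2) * r).eval (ξ i)) :
    polyInt (-1) 1 (derivative p ^ 2) ≤
      96 * N ^ 2 * polyInt (-1) 1 ((1 - X ^ 2) * r ^ 2) +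
        2 * polyInt (-1) 1 (derivative ((1 - X ^ 2) * r) ^ 2) := by
  obtain ⟨m, rfl⟩ := Nat.exists_eq_add_of_le' hN
  have h0 := hpr 0
  have h1 := hpr (Fin.last _)
  rw [hξ.apply_zero hN] at h0
  rw [hξ.apply_last hN] at h1
  obtain ⟨d, hd⟩ := exists_eq_one_sub_sq_mul_sum hp (by simpa using h0) (by simpa using h1)
  have hinv := polyInt_derivative_sq_le (N := m + 1) (s := Finset.Ico 1 (m + 1))
    (fun n hn => (Finset.mem_Ico.1 hn).2) d
  rw [← hd] at hinv
  set rp := ∑ n ∈ Finset.Ico 1 (m + 1), C (d n) * derivative (legendre n) with hrp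
  have hrpd : rp.degree < m := by
    refine mem_degreeLT.1 (Submodule.sum_mem _ fun n hn => ?_)
    rw [← smul_eq_C_mul]
    refine Submodule.smul_mem _ _ (mem_degreeLT.2 (degree_le_natDegree.trans_lt ?_))
    rw [natDegree_derivative_legendre]
    have := Finset.mem_Ico.1 hn
    exact_mod_cast (by omega : n - 1 < m)
  set η : Fin m → ℝ := fun j => ξ j.succ.castSucc with hη
  have hηinj : Function.Injective η := fun i j h => by
    simpa using hξ.strictMono.injective h
  have hηroot : ∀ j, (derivative (legendre (m + 1))).eval (η j) = 0 := fun j =>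
    hξ.eval_derivative_legendre_eq_zero hN (by simp [Fin.lt_def]) (by simp [Fin.lt_def])
  have heq : ∀ j, rp.eval (η j) = r.eval (η j) := by
    intro j
    have h := hpr j.succ.castSucc
    rw [hd, eval_mul, eval_mul] at h
    refine mul_left_cancel₀ ?_ h
    have := mem_Ioo_of_isRoot_derivative_legendre hN (hηroot j)
    simp only [hη] at this
    simp only [eval_sub, eval_one, eval_pow, eval_X]
    nlinarith [this.1, this.2]
  rw [polyInt_one_sub_sq_mul_sq hηinj hηroot hrpd, Finset.mul_sum] at hinv
  refine hinv.trans ?_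
  set q : ℝ[X] := C (96 * ((m + 1 : ℕ) : ℝ) ^ 2) * ((1 - X ^ 2) * r ^ 2) +
    C 2 * derivative ((1 - X ^ 2) * r) ^ 2 with hq
  have hqint : polyInt (-1) 1 q =
      96 * ((m + 1 : ℕ) : ℝ) ^ 2 * polyInt (-1) 1 ((1 - X ^ 2) * r ^ 2) +
        2 * polyInt (-1) 1 (derivative ((1 - X ^ 2) * r) ^ 2) := by
    rw [hq, map_add, polyInt_C_mul, polyInt_C_mul]
  have hadj := sum_polyInt_adjacent ξ q
  rw [hξ.apply_zero hN, hξ.apply_last hN, Fin.sum_univ_succ] at hadj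
  rw [← hqint, ← hadj]
  have hfirst : 0 ≤ polyInt (ξ (Fin.castSucc 0)) (ξ (Fin.succ 0)) q := by
    refine polyInt_nonneg (hξ.strictMono (Fin.castSucc_lt_succ)).le fun x hx => ?_
    simp only [hq, eval_add, eval_mul, eval_C, eval_pow, eval_sub, eval_one, eval_X]
    have hx0 : 0 ≤ 1 - x ^ 2 := by
      have h1 := (hξ.mem_Icc hN (Fin.castSucc 0)).1.trans hx.1
      have h2 := hx.2.trans (hξ.mem_Icc hN (Fin.succ 0)).2
      nlinarith
    positivity
  refine le_add_of_nonneg_of_le hfirst (Finset.sum_le_sum fun j _ => ?_)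
  have hN2 : 2 ≤ m + 1 := by have := j.pos; omega
  have := node_contribution_le hN2 (hξ.strictMono (Fin.castSucc_lt_succ (i := j.succ)))
    (hξ.mem_Icc hN _).2 (hηroot j) (hξ.isRoot j.succ.succ) r
  rw [heq]
  refine le_trans (le_of_eq ?_) this
  push_cast
  rw [add_assoc (m : ℝ) 1 1, one_add_one_eq_two]

/-! ### Edge polynomials -/

section Edge

variable {N : ℕ} {ξ : Fin (N + 1) → ℝ}

/-- An antiderivative of the edge polynomial `e_j`: the negative of the sum of the Lagrange
polynomials of the nodes to the left of the edge. -/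
noncomputable def edgePrimitive (ξ : Fin (N + 1) → ℝ) (j : Fin N) : ℝ[X] :=
  -∑ k ∈ Finset.Iic j.castSucc, lagrange ξ k

theorem derivative_edgePrimitive (ξ : Fin (N + 1) → ℝ) (j : Fin N) :
    derivative (edgePrimitive ξ j) = edge ξ j := by
  rw [edgePrimitive, edge, derivative_neg, derivative_sum]

theorem natDegree_edgePrimitive_le (hξ : Function.Injective ξ) (j : Fin N) :
    (edgePrimitive ξ j).natDegree ≤ N := by
  rw [edgePrimitive, natDegree_neg]
  refine natDegree_sum_le_of_forall_le _ _ fun k _ => ?_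
  rw [lagrange, Lagrange.natDegree_basis hξ.injOn (Finset.mem_univ k)]
  simp

theorem eval_edgePrimitive (hξ : Function.Injective ξ) (j : Fin N) (i : Fin (N + 1)) :
    (edgePrimitive ξ j).eval (ξ i) = if i ≤ j.castSucc then -1 else 0 := by
  have h : ∀ k, (lagrange ξ k).eval (ξ i) = if i = k then 1 else 0 := by
    intro k
    split_ifs with hik
    · rw [← hik, lagrange, Lagrange.eval_basis_self hξ.injOn (Finset.mem_univ i)]
    · rw [lagrange, Lagrange.eval_basis_of_ne (Ne.symm hik) (Finset.mem_univ i)]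
  rw [edgePrimitive, eval_neg, eval_finsetSum]
  simp only [h, Finset.sum_ite_eq, Finset.mem_Iic]
  split_ifs <;> simp

theorem eval_edgePrimitive_sub (hξ : Function.Injective ξ) (i j : Fin N) :
    (edgePrimitive ξ j).eval (ξ i.succ) - (edgePrimitive ξ j).eval (ξ i.castSucc) =
      if i = j then 1 else 0 := by
  rw [eval_edgePrimitive hξ, eval_edgePrimitive hξ]
  simp only [Fin.le_def, Fin.ext_iff, Fin.val_succ, Fin.val_castSucc]
  split_ifs <;> first | omega | norm_num

/-- The edge polynomials reproduce the derivatives of the polynomials of degree at most `N` from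
their increments over the edges. -/
theorem sum_sub_mul_edge (hξ : Function.Injective ξ) {p : ℝ[X]} (hp : p.natDegree ≤ N) :
    ∑ j, C (p.eval (ξ j.succ) - p.eval (ξ j.castSucc)) * edge ξ j = derivative p := by
  set q := ∑ j, C (p.eval (ξ j.succ) - p.eval (ξ j.castSucc)) * edgePrimitive ξ j with hq
  have hqd : q.natDegree ≤ N := natDegree_sum_le_of_forall_le _ _ fun j _ =>
    (natDegree_C_mul_le _ _).trans (natDegree_edgePrimitive_le hξ j)
  have hinc : ∀ i : Fin N, q.eval (ξ i.succ) - q.eval (ξ i.castSucc) =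
      p.eval (ξ i.succ) - p.eval (ξ i.castSucc) := by
    intro i
    simp only [hq, eval_finsetSum, eval_mul, eval_C]
    rw [← Finset.sum_sub_distrib]
    simp only [← mul_sub, eval_edgePrimitive_sub hξ, mul_ite, mul_one, mul_zero]
    simp
  have hconst : ∀ i : Fin (N + 1), (q - p).eval (ξ i) = (q - p).eval (ξ 0) := by
    intro i
    induction i using Fin.induction with
    | zero => rfl
    | succ i ih =>
      rw [← ih, eval_sub, eval_sub]
      linarith [hinc i]
  have hC : q - p = C ((q - p).eval (ξ 0)) := by
    refine eq_of_degrees_lt_of_eval_index_eq (v := ξ) Finset.univ hξ.injOn ?_ ?_ ?_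
    · rw [Finset.card_univ, Fintype.card_fin]
      refine degree_le_natDegree.trans_lt ?_
      have := natDegree_sub_le q p
      exact_mod_cast (by omega : (q - p).natDegree < N + 1)
    · rw [Finset.card_univ, Fintype.card_fin]
      exact degree_C_le.trans_lt (by exact_mod_cast Nat.succ_pos N)
    · intro i _
      rw [hconst i, eval_C]
  have h := congrArg derivative hC
  rw [derivative_C, derivative_sub, sub_eq_zero] at h
  rw [← h, hq, derivative_sum]
  refine Finset.sum_congr rfl fun j _ => ?_
  rw [derivative_C_mul, derivative_edgePrimitive]

end Edge

/-! ### Polynomial forms in `L²` -/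

theorem polyForm_add (p q : ℝ[X]) : polyForm (p + q) = polyForm p + polyForm q := by
  rw [polyForm, polyForm, polyForm, ← MemLp.toLp_add]
  congr 1
  ext x
  simp

theorem polyForm_C_mul (c : ℝ) (p : ℝ[X]) : polyForm (C c * p) = c • polyForm p := by
  rw [polyForm, polyForm, ← MemLp.toLp_const_smul]
  congr 1
  ext x
  simp

theorem polyForm_zero : polyForm 0 = 0 := by
  simpa using polyForm_C_mul 0 0

theorem polyForm_sum {ι : Type*} (s : Finset ι) (f : ι → ℝ[X]) :
    polyForm (∑ i ∈ s, f i) = ∑ i ∈ s, polyForm (f i) :=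
  map_sum (⟨⟨polyForm, polyForm_zero⟩, polyForm_add⟩ : ℝ[X] →+ L2Form1) f s

theorem norm_polyForm_sq (p : ℝ[X]) : ‖polyForm p‖ ^ 2 = polyInt (-1) 1 (p ^ 2) := by
  rw [← real_inner_self_eq_norm_sq, L2.inner_def, polyInt_apply,
    intervalIntegral.integral_of_le (by norm_num), ← integral_Icc_eq_integral_Ioc]
  refine integral_congr_ae ?_
  filter_upwards [(memLp_polynomial p).coeFn_toLp] with x hx
  rw [polyForm, hx, eval_pow]
  simp [pow_two]

theorem norm_polyForm_le_mul {p q : ℝ[X]} {c : ℝ} (hc : 0 ≤ c)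
    (h : polyInt (-1) 1 (p ^ 2) ≤ c ^ 2 * polyInt (-1) 1 (q ^ 2)) :
    ‖polyForm p‖ ≤ c * ‖polyForm q‖ := by
  refine le_of_sq_le_sq ?_ (by positivity)
  rwa [mul_pow, norm_polyForm_sq, norm_polyForm_sq]

theorem integral_polyForm (p : ℝ[X]) {a b : ℝ} (ha : -1 ≤ a) (hab : a ≤ b) (hb : b ≤ 1) :
    ∫ x in a..b, polyForm p x = polyInt a b p := by
  rw [polyInt_apply, intervalIntegral.integral_of_le hab, intervalIntegral.integral_of_le hab]
  refine integral_congr_ae ?_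
  have h : volume.restrict (Set.Ioc a b) ≤ volume.restrict (Set.Icc (-1 : ℝ) 1) :=
    Measure.restrict_mono (fun x (hx : x ∈ Set.Ioc a b) =>
      (⟨ha.trans hx.1.le, hx.2.trans hb⟩ : x ∈ Set.Icc (-1 : ℝ) 1)) le_rfl
  exact ae_mono h (memLp_polynomial p).coeFn_toLp

theorem denseRange_polyForm : DenseRange polyForm := by
  intro f
  rw [Metric.mem_closure_iff]
  intro ε hε
  set K : ℝ := ↑(measureUnivNNReal (volume.restrict (Set.Icc (-1 : ℝ) 1))) ^ (2 : ℝ≥0∞).toReal⁻¹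
  have hK : 0 ≤ K := by positivity
  obtain ⟨g, -, hg, hgc, hgL⟩ := (Lp.memLp f).exists_hasCompactSupport_eLpNorm_sub_le
    (by norm_num) (ε := ENNReal.ofReal (ε / 2)) (by simpa using hε)
  have hδ : 0 < ε / (2 * (K + 1)) := by positivity
  obtain ⟨p, hp⟩ := exists_polynomial_near_of_continuousOn (-1) 1 g hgc.continuousOn _ hδ
  refine ⟨polyForm p, ⟨p, rfl⟩, ?_⟩
  have h1 : dist f (hgL.toLp g) ≤ ε / 2 := by
    rw [← ENNReal.ofReal_le_ofReal_iff (by positivity), ← edist_dist]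
    conv_lhs => rw [← Lp.toLp_coeFn f (Lp.memLp f)]
    rwa [Lp.edist_toLp_toLp]
  have h2 : dist (hgL.toLp g) (polyForm p) ≤ K * (ε / (2 * (K + 1))) := by
    rw [dist_eq_norm]
    refine Lp.norm_le_of_ae_bound hδ.le ?_
    filter_upwards [Lp.coeFn_sub (hgL.toLp g) (polyForm p), hgL.coeFn_toLp,
      (memLp_polynomial p).coeFn_toLp, ae_restrict_mem measurableSet_Icc] with x hx hxg hxp hxI
    rw [hx, Pi.sub_apply, hxg, polyForm, hxp, Real.norm_eq_abs, abs_sub_comm]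
    exact (hp x hxI).le
  have h3 : K * (ε / (2 * (K + 1))) < ε / 2 := by
    rw [← mul_div_assoc, div_lt_div_iff₀ (by positivity) (by positivity)]
    nlinarith
  linarith [dist_triangle f (hgL.toLp g) (polyForm p)]

/-! ### The projection -/

/-- The map `b ↦ ∑_j (∫_{ξ_j}^{ξ_{j+1}} b) e_j` as a continuous operator, each integral being the
inner product with the indicator function of the edge. -/
noncomputable def projection {N : ℕ} (ξ : Fin (N + 1) → ℝ) : L2Form1 →L[ℝ] L2Form1 :=
  ∑ j : Fin N, (innerSL ℝ (indicatorConstLp 2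
    (measurableSet_Ioc : MeasurableSet (Set.Ioc (ξ j.castSucc) (ξ j.succ)))
      (measure_ne_top _ _) (1 : ℝ) : L2Form1)).smulRight (polyForm (edge ξ j))

section Projection

variable {N : ℕ} {ξ : Fin (N + 1) → ℝ}

theorem projection_apply (hN : 1 ≤ N) (hξ : IsGaussLobattoGrid N ξ) (b : L2Form1) :
    projection ξ b = reconstruction ξ (reduction ξ b) := by
  rw [projection, reconstruction, sum_apply]
  refine Finset.sum_congr rfl fun j _ => ?_
  have hle : ξ j.castSucc ≤ ξ j.succ := (hξ.strictMono Fin.castSucc_lt_succ).le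
  have hsub : Set.Ioc (ξ j.castSucc) (ξ j.succ) ⊆ Set.Icc (-1 : ℝ) 1 := fun x hx =>
    ⟨(hξ.mem_Icc hN _).1.trans hx.1.le, hx.2.trans (hξ.mem_Icc hN _).2⟩
  rw [ContinuousLinearMap.smulRight_apply, innerSL_apply_apply, L2.inner_indicatorConstLp_one,
    Measure.restrict_restrict measurableSet_Ioc, Set.inter_eq_left.2 hsub, reduction,
    intervalIntegral.integral_of_le hle]

theorem projection_mem (hN : 1 ≤ N) (hξ : IsGaussLobattoGrid N ξ) (b : L2Form1) :
    projection ξ b ∈ discreteForms1 ξ := by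
  rw [projection_apply hN hξ, reconstruction]
  exact Submodule.sum_mem _ fun j _ =>
    Submodule.smul_mem _ _ (Submodule.subset_span (Set.mem_range_self j))

/-- On a polynomial form `dA` the projection is `dp` for every polynomial `p` of degree at most `N`
with the values of `A` at the nodes. -/
theorem projection_polyForm_derivative (hN : 1 ≤ N) (hξ : IsGaussLobattoGrid N ξ) {A p : ℝ[X]}
    (hp : p.natDegree ≤ N) (h : ∀ i, p.eval (ξ i) = A.eval (ξ i)) :
    projection ξ (polyForm (derivative A)) = polyForm (derivative p) := by
  rw [projection_apply hN hξ, reconstruction, ← sum_sub_mul_edge hξ.strictMono.injective hp,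
    polyForm_sum]
  refine Finset.sum_congr rfl fun j _ => ?_
  rw [polyForm_C_mul, reduction, integral_polyForm _ (hξ.mem_Icc hN _).1
    (hξ.strictMono Fin.castSucc_lt_succ).le (hξ.mem_Icc hN _).2, polyInt_derivative, h, h]

theorem projection_of_mem (hN : 1 ≤ N) (hξ : IsGaussLobattoGrid N ξ) {b : L2Form1}
    (hb : b ∈ discreteForms1 ξ) : projection ξ b = b := by
  induction hb using Submodule.span_induction with
  | mem b hb =>
    obtain ⟨j, rfl⟩ := hb
    simp only [← derivative_edgePrimitive]
    exact projection_polyForm_derivative hN hξ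
      (natDegree_edgePrimitive_le hξ.strictMono.injective j) fun _ => rfl
  | zero => exact map_zero _
  | add b c _ _ hb hc => rw [map_add, hb, hc]
  | smul a b _ hb => rw [map_smul, hb]

/-- On the span of the Legendre polynomials `P_n`, `n ≥ N`, the interpolation estimate and the
approximation inequality bound the projection. -/
theorem norm_projection_sum_legendre_le (hN : 1 ≤ N) (hξ : IsGaussLobattoGrid N ξ)
    {s : Finset ℕ} (hs : ∀ n ∈ s, N ≤ n) (c : ℕ → ℝ) :
    ‖projection ξ (polyForm (∑ n ∈ s, C (c n) * legendre n))‖ ≤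
      10 * ‖polyForm (∑ n ∈ s, C (c n) * legendre n)‖ := by
  obtain ⟨A, hA, -⟩ := exists_derivative_eq (∑ n ∈ s, C (c n) * legendre n)
  set f := A - C (A.eval (-1)) with hf
  have hfd : derivative f = ∑ n ∈ s, C (c n) * legendre n := by
    rw [hf, derivative_sub, derivative_C, sub_zero, hA]
  have hs0 : 0 ∉ s := fun h => by
    have := hs 0 h
    omega
  have hfr := eq_one_sub_sq_mul_sum_of_derivative_eq (by simp [hf]) hs0 hfd
  have happ := le_polyInt_derivative_sq hs fun n => -(c n / ((n : ℝ) * (n + 1)))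
  set r := ∑ n ∈ s, C (-(c n / ((n : ℝ) * (n + 1)))) * derivative (legendre n)
  set p := Lagrange.interpolate Finset.univ ξ fun i => f.eval (ξ i) with hp
  have hinj := hξ.strictMono.injective
  have hpd : p.natDegree ≤ N := by
    have := Lagrange.degree_interpolate_lt (s := Finset.univ) (v := ξ)
      (fun i => f.eval (ξ i)) hinj.injOn
    rw [Finset.card_univ, Fintype.card_fin, ← hp] at this
    rcases eq_or_ne p 0 with h0 | h0
    · simp [h0]
    · exact Nat.lt_succ_iff.1 ((natDegree_lt_iff_degree_lt h0).2 this)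
  have hpf : ∀ i, p.eval (ξ i) = f.eval (ξ i) := fun i =>
    Lagrange.eval_interpolate_at_node _ hinj.injOn (Finset.mem_univ i)
  rw [← hfd, projection_polyForm_derivative hN hξ hpd hpf]
  refine norm_polyForm_le_mul (by norm_num) ?_
  have hmain := polyInt_derivative_interpolant_sq_le hN hξ hpd (r := r) (by rwa [← hfr])
  rw [← hfr] at hmain happ
  have hD : 0 ≤ polyInt (-1) 1 (derivative f ^ 2) :=
    polyInt_nonneg (by norm_num) fun x _ => by rw [eval_pow]; positivity
  linarith

theorem norm_polyForm_sum_legendre_le {s t : Finset ℕ} (h : s ⊆ t) (c : ℕ → ℝ) :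
    ‖polyForm (∑ n ∈ s, C (c n) * legendre n)‖ ≤ ‖polyForm (∑ n ∈ t, C (c n) * legendre n)‖ := by
  rw [← one_mul ‖polyForm (∑ n ∈ t, C (c n) * legendre n)‖]
  refine norm_polyForm_le_mul zero_le_one ?_
  rw [polyInt_sum_legendre_sq, polyInt_sum_legendre_sq, one_pow, one_mul]
  exact Finset.sum_le_sum_of_subset_of_nonneg h fun n _ _ => by positivity

theorem norm_projection_polyForm_le (hN : 1 ≤ N) (hξ : IsGaussLobattoGrid N ξ) (b : ℝ[X]) :
    ‖projection ξ (polyForm b)‖ ≤ 11 * ‖polyForm b‖ := by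
  have hb : b.degree < (N + (b.natDegree + 1) : ℕ) :=
    degree_le_natDegree.trans_lt (by exact_mod_cast (by omega : b.natDegree < _))
  obtain ⟨c, hc⟩ := exists_eq_sum_legendre _ hb
  set M := N + (b.natDegree + 1)
  have hNM : N ≤ M := Nat.le_add_right _ _
  set b₁ := ∑ n ∈ Finset.range N, C (c n) * legendre n with hb₁
  set b₂ := ∑ n ∈ Finset.Ico N M, C (c n) * legendre n
  have hsplit : b = b₁ + b₂ := by rw [hc, Finset.sum_range_add_sum_Ico _ hNM]
  have h₁ : ‖polyForm b₁‖ ≤ ‖polyForm b‖ := by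
    rw [hc]
    exact norm_polyForm_sum_legendre_le (Finset.range_subset_range.2 hNM) c
  have h₂ : ‖polyForm b₂‖ ≤ ‖polyForm b‖ := by
    rw [hc]
    refine norm_polyForm_sum_legendre_le (fun n hn => ?_) c
    exact Finset.mem_range.2 (Finset.mem_Ico.1 hn).2
  have h₃ : projection ξ (polyForm b₁) = polyForm b₁ := by
    obtain ⟨A, hA, hAd⟩ := exists_derivative_eq b₁
    have : b₁.natDegree ≤ N - 1 := natDegree_sum_le_of_forall_le _ _ fun n hn => by
      refine (natDegree_C_mul_le _ _).trans ?_
      rw [natDegree_legendre]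
      have := Finset.mem_range.1 hn
      omega
    rw [← hA]
    exact projection_polyForm_derivative hN hξ (by omega) fun _ => rfl
  have h₄ := norm_projection_sum_legendre_le hN hξ (s := Finset.Ico N M)
    (fun n hn => (Finset.mem_Ico.1 hn).1) c
  calc ‖projection ξ (polyForm b)‖ = ‖polyForm b₁ + projection ξ (polyForm b₂)‖ := by
        conv_lhs => rw [hsplit]
        rw [polyForm_add, map_add, h₃]
    _ ≤ ‖polyForm b₁‖ + ‖projection ξ (polyForm b₂)‖ := norm_add_le _ _
    _ ≤ 11 * ‖polyForm b‖ := by linarith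

theorem norm_projection_le (hN : 1 ≤ N) (hξ : IsGaussLobattoGrid N ξ) (b : L2Form1) :
    ‖projection ξ b‖ ≤ 11 * ‖b‖ :=
  denseRange_polyForm.induction_on b
    (isClosed_le (projection ξ).continuous.norm (continuous_const.mul continuous_norm))
    (norm_projection_polyForm_le hN hξ)

end Projection

end MimeticSEM

theorem proposition4p7 :
    ∃ C : ℝ, 0 < C ∧ ∀ (N : ℕ), 1 ≤ N → ∀ ξ : Fin (N + 1) → ℝ,
      MimeticSEM.IsGaussLobattoGrid N ξ →
      ∃ π_h : MimeticSEM.L2Form1 →L[ℝ] MimeticSEM.discreteForms1 ξ,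
        (∀ b, (π_h b : MimeticSEM.L2Form1) =
          MimeticSEM.reconstruction ξ (MimeticSEM.reduction ξ b)) ∧
        (∀ b : MimeticSEM.discreteForms1 ξ, π_h (b : MimeticSEM.L2Form1) = b) ∧
        ∀ b, ‖π_h b‖ ≤ C * ‖b‖ := by
  refine ⟨11, by norm_num, fun N hN ξ hξ => ⟨(MimeticSEM.projection ξ).codRestrict
    (MimeticSEM.discreteForms1 ξ) (MimeticSEM.projection_mem hN hξ),
    MimeticSEM.projection_apply hN hξ, fun b => Subtype.ext ?_, fun b => ?_⟩⟩
  · exact MimeticSEM.projection_of_mem hN hξ b.2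
  · exact MimeticSEM.norm_projection_le hN hξ b
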